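/- **Theorem (Convergence of RS-RSG).** *Setting.* Let $N\ge 1$, $n_i\ge 1$, $\eta>0$. Consider the stochastic $N$-player game $$\min_{x_i\in X_i}\ f_i(x_i,x_{-i})=h_i(x_i)+m_i(x_i,x_{-i}),\qquad h_i(x_i)=\mathbb E[\tilde h_i(x_i,\xi)],\quad m_i(x)=\mathbb E[\tilde m_i(x,\xi)],\qquad i=1,\dots,N,$$ where each $X_i\subseteq\mathbb R^{n_i}$ is closed and convex, $X=\prod_i X_i$, each $\tilde h_i(\bullet,\xi)$ is $L_i$-Lipschitz on an open set $U_i$ (independent of $\xi$) containing $X_i+\eta\mathbb B$ with $\mathbb B$ the closed unit ball, and each $\tilde m_i(\bullet,x_{-i},\xi)$ is continuously differentiable on an open set $O_i\supseteq X_i$ (independent of $\xi$ and of $x_{-i}$) for all $x_{-i}\in X_{-i}$ and all $\xi$; $\tilde h_i,\tilde m_i$ are measurable, and the expectations defining $h_i$ on $U_i$ and $m_i(\bullet,x_{-i})$ on $O_i$ exist. Let $h_i^\eta(x_i)=\mathbb E[h_i(x_i+\eta u)]$ with $u$ uniform on the unit ball of $\mathbb R^{n_i}$, let $f_i^\eta=h_i^\eta+m_i$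 be the objectives of the smoothed game, and $F^\eta(x)=(\nabla_{x_i}f_i^\eta(x))_{i=1}^N$. *Assumptions.* (C1) The smoothed game has a potential function $P^\eta$ on $X$, that is, $P^\eta(x_i^1,x_{-i})-P^\eta(x_i^2,x_{-i})=f_i^\eta(x_i^1,x_{-i})-f_i^\eta(x_i^2,x_{-i})$ for all $i$, $x_i^1,x_i^2\in X_i$, $x_{-i}\in X_{-i}$; it is $L(\eta)$-smooth on $X$ (differentiable with $L(\eta)$-Lipschitz gradient), $L(\eta)>0$, and attains its maximum $P^\eta_{\max}$ and minimum $P^\eta_{\min}$ over $X$, with $P^\eta_{\min}<P^\eta_{\max}$. (C2) For all $x\in X$ and $i$, $m_i(\bullet,x_{-i})$ is differentiable at $x_i$ and $\mathbb E[\nabla_{x_i}\tilde m_i(x,\xi)]=\nabla_{x_i}m_i(x)$. (C3) For some $\sigma_m>0$, $\mathbb E\|\nabla_{x_i}\tilde m_i(x,\xi)-\nabla_{x_i}m_i(x)\|^2\le\sigma_m^2$ for all $x\in X$ and $i$. *Scheme.* Start from $x^0\in X$. At iteration $k$, each player $i$ draws i.i.d. pairs $(\xi^k_{i,l},v^k_{i,l})$,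 $l=1,\dots,S$, where $\xi^k_{i,l}$ is distributed as $\xi$, $v^k_{i,l}$ is uniform on the sphere of radius $\eta$ in $\mathbb R^{n_i}$ and independent of $\xi^k_{i,l}$, and samples of different iterations are independent. With $\Pi$ the Euclidean projection, the players update simultaneously $$x_i^{k+1}=\Pi_{X_i}\Big[x_i^k-\frac{\gamma_k}{S}\sum_{l=1}^{S}\Big(\frac{n_i}{2\eta}\big(\tilde h_i(x_i^k+v^k_{i,l},\xi^k_{i,l})-\tilde h_i(x_i^k-v^k_{i,l},\xi^k_{i,l})\big)\frac{v^k_{i,l}}{\|v^k_{i,l}\|}+\nabla_{x_i}\tilde m_i(x^k,\xi^k_{i,l})\Big)\Big].$$ The output is $x^R$, where $R$ is independent of all samples and uniform on $\{1,\dots,T\}$. *Parameters.* Let $\sigma=\big(32\sqrt{2\pi}\,L_{\max}^2n_{\max}+2\sigma_m^2\big)^{1/2}$ with $L_{\max}=\max_iL_i$, $n_{\max}=\max_in_i$, and $D(\eta)=\big((P^\eta_{\max}-P^\eta_{\min})/L(\eta)\big)^{1/2}$. Given budgets of $M_0$ zeroth-order and $M_1$ first-order stochastic oracle calls, put $M=\min\{M_0/2,M_1\}$,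 $$S=\Big\lceil\frac{\sigma\sqrt{6M}}{4L(\eta)D(\eta)}\Big\rceil,\qquad T=\min\Big\{\Big\lfloor\frac{M_0/2}{SN}\Big\rfloor,\Big\lfloor\frac{M_1}{SN}\Big\rfloor\Big\},\qquad \gamma_k=\frac1{2L(\eta)}\quad(k=1,\dots,T).$$ *Conclusion.* There is a threshold $\bar M$ depending only on $N$, $(n_i)$, $(L_i)$, $\sigma_m$, $L(\eta)$, $P^\eta_{\min}$, $P^\eta_{\max}$ such that, for all $M_0,M_1\ge\bar M$, one has $T\ge1$ and the residual $G^\eta_\gamma(x)=\frac1\gamma\big(x-\Pi_X[x-\gamma F^\eta(x)]\big)$ satisfies $$\mathbb E\big[\|G^\eta_{\gamma_R}(x^R)\|^2\big]\le\frac{16\,L(\eta)^2D(\eta)^2N}{M}+\frac{8\sqrt6\,L(\eta)D(\eta)N\sigma}{\sqrt M},$$ the expectation on the left being finite. -/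

import Mathlib

open MeasureTheory ProbabilityTheory Set Filter Topology
open scoped NNReal ENNReal Pointwise

noncomputable section

/-- The Euclidean space `ℝ^d` in which a single player chooses. -/
abbrev Strat (d : ℕ) : Type := EuclideanSpace ℝ (Fin d)

/-- Strategy profiles `x = (x_1, …, x_N)` with `x_i ∈ ℝ^{n_i}`, carrying the Euclidean norm of
`ℝ^{n_1 + ⋯ + n_N}`. -/
abbrev Profile {N : ℕ} (n : Fin N → ℕ) : Type := PiLp 2 (fun i => Strat (n i))

/-- The profile `(y, x_{-i})`. -/
def deviate {N : ℕ} {n : Fin N → ℕ} (x : Profile n) (i : Fin N) (y : Strat (n i)) : Profile n :=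
  WithLp.toLp 2 (Function.update (fun j => x j) i y)

open Classical in
/-- Euclidean projection onto `K`: the nearest point of `K` (it exists and is unique if `K` is
nonempty, closed and convex). -/
def euclProj {E : Type*} [NormedAddCommGroup E] (K : Set E) (x : E) : E :=
  if h : ∃ y ∈ K, ∀ z ∈ K, ‖x - y‖ ≤ ‖x - z‖ then h.choose else x

/-- Randomized smoothing `f^η(x) = 𝔼[f (x + η u)]`, with `u` uniform on the closed unit ball. -/
def smoothing {d : ℕ} (η : ℝ) (f : Strat d → ℝ) (x : Strat d) : ℝ :=
  ⨍ u in Metric.closedBall (0 : Strat d) 1, f (x + η • u)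

/-- The uniform distribution on the sphere of radius `η` centred at the origin of `ℝ^d`:
normalized surface measure of the unit sphere, scaled by `η`. -/
def sphereUniform (d : ℕ) (η : ℝ) : Measure (Strat d) :=
  (((volume : Measure (Strat d)).toSphere univ)⁻¹ • (volume : Measure (Strat d)).toSphere).map
    (fun u : Metric.sphere (0 : Strat d) 1 => η • (u : Strat d))

/-- The data of a stochastic game in which player `i` solves
`min_{x_i ∈ X_i} 𝔼[h̃_i(x_i, ξ)] + 𝔼[m̃_i(x_i, x_{-i}, ξ)]`. -/
structure StochGame {N : ℕ} (n : Fin N → ℕ) (Ξ : Type*) where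
  /-- the strategy sets `X_i` -/
  X : (i : Fin N) → Set (Strat (n i))
  /-- the private terms `h̃_i(x_i, ξ)` -/
  ht : (i : Fin N) → Strat (n i) → Ξ → ℝ
  /-- the coupling terms `m̃_i(x, ξ)` -/
  mt : (i : Fin N) → Profile n → Ξ → ℝ

namespace StochGame

variable {N : ℕ} {n : Fin N → ℕ} {Ξ : Type*}

/-- The product set `X = ∏ X_i`. -/
def feasible (G : StochGame n Ξ) : Set (Profile n) := {x | ∀ i, x i ∈ G.X i}

/-- `h_i(y) = 𝔼[h̃_i(y, ξ)]`. -/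
def h [MeasurableSpace Ξ] (G : StochGame n Ξ) (μ : Measure Ξ) (i : Fin N) (y : Strat (n i)) : ℝ :=
  ∫ s, G.ht i y s ∂μ

/-- `m_i(x) = 𝔼[m̃_i(x, ξ)]`. -/
def m [MeasurableSpace Ξ] (G : StochGame n Ξ) (μ : Measure Ξ) (i : Fin N) (x : Profile n) : ℝ :=
  ∫ s, G.mt i x s ∂μ

/-- The objectives `f_i^η(x) = h_i^η(x_i) + m_i(x)` of the smoothed game. -/
def fSmooth [MeasurableSpace Ξ] (G : StochGame n Ξ) (μ : Measure Ξ) (η : ℝ) (i : Fin N)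
    (x : Profile n) : ℝ :=
  smoothing η (G.h μ i) (x i) + G.m μ i x

/-- `F^η(x) = (∇_{x_i} f_i^η(x))_i`. -/
def FSmooth [MeasurableSpace Ξ] (G : StochGame n Ξ) (μ : Measure Ξ) (η : ℝ) (x : Profile n) :
    Profile n :=
  WithLp.toLp 2 (fun i => gradient (fun y => G.fSmooth μ η i (deviate x i y)) (x i))

/-- The residual `G^η_γ(x) = γ⁻¹ (x - Π_X[x - γ F^η(x)])`. -/
def residual [MeasurableSpace Ξ] (G : StochGame n Ξ) (μ : Measure Ξ) (η γ : ℝ) (x : Profile n) :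
    Profile n :=
  γ⁻¹ • (x - euclProj G.feasible (x - γ • G.FSmooth μ η x))

/-- The partial gradient `∇_{x_i} m̃_i(x, s)`. -/
def gradMt (G : StochGame n Ξ) (i : Fin N) (x : Profile n) (s : Ξ) : Strat (n i) :=
  gradient (fun y => G.mt i (deviate x i y) s) (x i)

/-- The standing assumptions on the game for the smoothing parameter `η`. Both the gradient of the
smoothing at points of `X_i` and the sampled values `h̃_i(x_i ± v, ξ)` with `‖v‖ = η` involve
`h̃_i` on `X_i + η𝔹`, so Lipschitz continuity is required on a neighbourhood of that set. -/
structure IsLipschitzGame [MeasurableSpace Ξ] (G : StochGame n Ξ) (μ : Measure Ξ)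
    (η : ℝ) (Lip : Fin N → ℝ≥0) : Prop where
  closed : ∀ i, IsClosed (G.X i)
  convex : ∀ i, Convex ℝ (G.X i)
  measurable_ht : ∀ i, Measurable (fun p : Strat (n i) × Ξ => G.ht i p.1 p.2)
  measurable_mt : ∀ i, Measurable (fun p : Profile n × Ξ => G.mt i p.1 p.2)
  lipschitz : ∀ i, ∃ U : Set (Strat (n i)), IsOpen U ∧ G.X i + Metric.closedBall 0 η ⊆ U ∧
    (∀ s, LipschitzOnWith (Lip i) (fun y => G.ht i y s) U) ∧
    ∀ y ∈ U, Integrable (fun s => G.ht i y s) μ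
  smooth : ∀ i, ∃ O : Set (Strat (n i)), IsOpen O ∧ G.X i ⊆ O ∧ ∀ x ∈ G.feasible,
    (∀ s, ContDiffOn ℝ 1 (fun y => G.mt i (deviate x i y) s) O) ∧
    ∀ y ∈ O, Integrable (fun s => G.mt i (deviate x i y) s) μ

/-- `P` is a potential function on `X` of the game with objectives `f_i^η`. -/
def IsSmoothedPotential [MeasurableSpace Ξ] (G : StochGame n Ξ) (μ : Measure Ξ) (η : ℝ)
    (P : Profile n → ℝ) : Prop :=
  ∀ i, ∀ x ∈ G.feasible, ∀ y₁ ∈ G.X i, ∀ y₂ ∈ G.X i,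
    P (deviate x i y₁) - P (deviate x i y₂) =
      G.fSmooth μ η i (deviate x i y₁) - G.fSmooth μ η i (deviate x i y₂)

/-- Unbiasedness: `m_i(•, x_{-i})` is differentiable at `x_i` and
`𝔼[∇_{x_i} m̃_i(x, ξ)] = ∇_{x_i} m_i(x)`. -/
def Unbiased [MeasurableSpace Ξ] (G : StochGame n Ξ) (μ : Measure Ξ) : Prop :=
  ∀ i, ∀ x ∈ G.feasible,
    DifferentiableAt ℝ (fun y => G.m μ i (deviate x i y)) (x i) ∧
    Integrable (fun s => G.gradMt i x s) μ ∧
    ∫ s, G.gradMt i x s ∂μ = gradient (fun y => G.m μ i (deviate x i y)) (x i)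

/-- Bounded second moment:
`𝔼 ‖∇_{x_i} m̃_i(x, ξ) - ∇_{x_i} m_i(x)‖² ≤ σ_m²`. -/
def BoundedSecondMoment [MeasurableSpace Ξ] (G : StochGame n Ξ) (μ : Measure Ξ) (σm : ℝ) : Prop :=
  ∀ i, ∀ x ∈ G.feasible,
    Integrable (fun s =>
      ‖G.gradMt i x s - gradient (fun y => G.m μ i (deviate x i y)) (x i)‖ ^ 2) μ ∧
    ∫ s, ‖G.gradMt i x s - gradient (fun y => G.m μ i (deviate x i y)) (x i)‖ ^ 2 ∂μ ≤ σm ^ 2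

/-- The zeroth-order estimator
`(n_i / 2η) (h̃_i(x_i + v, s) - h̃_i(x_i - v, s)) v / ‖v‖`. -/
def zerothOrder (G : StochGame n Ξ) (η : ℝ) (i : Fin N) (x : Profile n) (s : Ξ)
    (v : Strat (n i)) : Strat (n i) :=
  ((n i : ℝ) / (2 * η) * (G.ht i (x i + v) s - G.ht i (x i - v) s)) • (‖v‖⁻¹ • v)

/-- The mini-batch direction of player `i` at `x`, built from the sample pairs `(ξ_l, v_l)`,
`l = 1, …, S`. -/
def batchDirection (G : StochGame n Ξ) (η : ℝ) {S : ℕ} (i : Fin N) (x : Profile n)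
    (w : Fin S → Ξ × Strat (n i)) : Strat (n i) :=
  (S : ℝ)⁻¹ • (∑ l, G.zerothOrder η i x (w l).1 (w l).2) +
    (S : ℝ)⁻¹ • (∑ l, G.gradMt i x (w l).1)

/-- The iterates `x^0, x^1, …` of the scheme, driven by the realized samples: `w k i l` is the
pair `(ξ^k_{i,l}, v^k_{i,l})`. Each iteration uses, over all players, `S N` first-order calls and
`2 S N` zeroth-order calls. -/
def iterate (G : StochGame n Ξ) (η : ℝ) (γ : ℕ → ℝ) {S : ℕ} (x₀ : Profile n)
    (w : ℕ → (i : Fin N) → Fin S → Ξ × Strat (n i)) : ℕ → Profile n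
  | 0 => x₀
  | k + 1 => WithLp.toLp 2 (fun i =>
      euclProj (G.X i) ((G.iterate η γ x₀ w k) i
        - γ k • G.batchDirection η i (G.iterate η γ x₀ w k) (w k i)))

end StochGame

/-- `P` is `L`-smooth on `X`: it is differentiable on `X` with an `L`-Lipschitz gradient. -/
def IsLSmoothOn {E : Type*} [NormedAddCommGroup E] [InnerProductSpace ℝ E] [CompleteSpace E]
    (L : ℝ) (P : E → ℝ) (X : Set E) : Prop :=
  ∃ g : E → E, (∀ x ∈ X, HasGradientWithinAt P (g x) X x) ∧
    ∀ x ∈ X, ∀ y ∈ X, ‖g x - g y‖ ≤ L * ‖x - y‖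

/-- `σ = (32 √(2π) L_max² n_max + 2 σ_m²)^{1/2}`. -/
def sigmaTotal {N : ℕ} (n : Fin N → ℕ) (Lip : Fin N → ℝ≥0) (σm : ℝ) : ℝ :=
  √(32 * √(2 * Real.pi) * (⨆ i, (Lip i : ℝ)) ^ 2 * (⨆ i, (n i : ℝ)) + 2 * σm ^ 2)

/-- `D(η) = ((P_max - P_min) / L(η))^{1/2}`. -/
def rangeD (Pmin Pmax L : ℝ) : ℝ := √((Pmax - Pmin) / L)

/-- `M = min {M₀ / 2, M₁}`. -/
def budget (M₀ M₁ : ℕ) : ℝ := min ((M₀ : ℝ) / 2) (M₁ : ℝ)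

/-- `S = ⌈σ √(6M) / (4 L D)⌉`. -/
def batchSize (σ L D M : ℝ) : ℕ := ⌈σ * √(6 * M) / (4 * L * D)⌉₊

/-- The number `min {⌊(M₀/2)/(S N)⌋, ⌊M₁/(S N)⌋}` of iterations that `M₀` zeroth-order and `M₁`
first-order calls allow. -/
def iterLimit (N S M₀ M₁ : ℕ) : ℕ :=
  min ⌊((M₀ : ℝ) / 2) / ((S : ℝ) * N)⌋₊ ⌊(M₁ : ℝ) / ((S : ℝ) * N)⌋₊

/-- The randomness of the scheme on `(Ω, Prb)`: `w k i l = (ξ^k_{i,l}, v^k_{i,l})` has law `μ` times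
the uniform law on the sphere of radius `η`; each player's batch at an iteration is i.i.d.;
different iterations are independent (nothing is asked across players within an iteration); and
the output index `R` is uniform on `{1, …, T}` and independent of all samples. -/
structure IsSampling {N : ℕ} {n : Fin N → ℕ} {Ξ Ω : Type*} [MeasurableSpace Ξ]
    [MeasurableSpace Ω] (μ : Measure Ξ) (Prb : Measure Ω) (η : ℝ) (S T : ℕ)
    (w : ℕ → (i : Fin N) → Fin S → Ω → Ξ × Strat (n i)) (R : Ω → ℕ) : Prop where
  measurable_w : ∀ k i l, Measurable (w k i l)
  measurable_R : Measurable R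
  law_w : ∀ k i l, Prb.map (w k i l) = μ.prod (sphereUniform (n i) η)
  indep_batch : ∀ k i, iIndepFun (fun l => w k i l) Prb
  indep_iter : iIndepFun (fun (k : ℕ) (ω : Ω) (i : Fin N) (l : Fin S) => w k i l ω) Prb
  law_R : ∀ k ∈ Finset.Icc 1 T, Prb {ω | R ω = k} = (T : ℝ≥0∞)⁻¹
  indep_R : IndepFun R (fun (ω : Ω) (k : ℕ) (i : Fin N) (l : Fin S) => w k i l ω) Prb

end

/-! Along feasible directions $F^\eta$ is the gradient of the potential
(`IsSmoothedPotential.inner_FSmooth_eq`), and projecting player by player is projecting onto $X$. So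
the scheme is projected stochastic gradient descent for $P^\eta$. Let $p$ be the actual step from
$x$, $q$ the exact one, and $\delta$ the error of the mini-batch direction. With $\gamma = 1/(2L)$
the descent lemma and the projection inequalities give $\frac{3L}{4}\|x-q\|^2 \le
P(x)-P(p)+\frac{7}{8L}\|\delta\|^2-\langle\delta,q-x\rangle$ (`norm_sub_sq_le_of_inexact_descent`).
Since $q$ depends on $x$ alone and $x$ is independent of the current batch, the last term has mean
zero, and $\mathbb E\|\delta\|^2\le N\sigma^2/S$. The residual is $2L(x-q)$; the potential
differences telescope over $k=1,\dots,T$, which gives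
$\frac{16L}{3}\frac{P_{\max}-P_{\min}}{T}+\frac{14}{3}\frac{N\sigma^2}{S}$ (`integral_residual_le`).
The prescribed $S$ makes both terms of order $M^{-1/2}$ (`rate_le`).

Two facts about the zeroth-order estimator carry the probabilistic part. It is unbiased for $\nabla
h_i^\eta$: by Rademacher's theorem the gradient of the smoothing is a ball average of derivatives,
and the divergence theorem for Lipschitz functions (`integral_lineDeriv_ball`) turns it into a
sphere average, which is then symmetrized. Its second moment is linear in $n_i$: the symmetric
difference of $\tilde h_i$ is an odd Lipschitz function on the sphere, and such functions have mean
square of order $1/n_i$ (`integral_sq_toSphere_le`). The latter comes from a Gaussian Poincaré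
inequality for odd functions (`integral_sq_le_of_lipschitz_of_odd`), applied to the $1$-homogeneous
extension and read in polar coordinates. -/

/-! ### Euclidean projection onto closed convex sets. -/

section EuclProj
variable {E : Type*} [NormedAddCommGroup E] [InnerProductSpace ℝ E]

theorem euclProj_spec [CompleteSpace E] {K : Set E} (hc : IsClosed K) (hK : Convex ℝ K)
    (hne : K.Nonempty) (x : E) :
    euclProj K x ∈ K ∧ ∀ z ∈ K, inner ℝ (x - euclProj K x) (z - euclProj K x) ≤ 0 := by
  have hex : ∃ y ∈ K, ∀ z ∈ K, ‖x - y‖ ≤ ‖x - z‖ := by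
    obtain ⟨y, hy, hmin⟩ := exists_norm_eq_iInf_of_complete_convex hne hc.isComplete hK x
    refine ⟨y, hy, fun z hz => hmin ▸ ciInf_le ⟨0, ?_⟩ (⟨z, hz⟩ : K)⟩
    rintro _ ⟨w, rfl⟩
    exact norm_nonneg _
  have hp : euclProj K x = hex.choose := by simp only [euclProj, dif_pos hex]
  obtain ⟨h1, h2⟩ := hex.choose_spec
  rw [← hp] at h1 h2
  refine ⟨h1, (norm_eq_iInf_iff_real_inner_le_zero hK h1).1 (le_antisymm ?_ ?_)⟩
  · have : Nonempty K := hne.to_subtype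
    exact le_ciInf fun w => h2 w w.2
  · refine ciInf_le ⟨0, ?_⟩ (⟨_, h1⟩ : K)
    rintro _ ⟨w, rfl⟩
    exact norm_nonneg _

/-- Two points satisfying the variational inequalities of projections onto a common set are at
most as far apart as the projected points. -/
theorem norm_sub_le_of_variational {K : Set E} {x y p q : E} (hp : p ∈ K) (hq : q ∈ K)
    (h1 : ∀ z ∈ K, inner ℝ (x - p) (z - p) ≤ 0) (h2 : ∀ z ∈ K, inner ℝ (y - q) (z - q) ≤ 0) :
    ‖p - q‖ ≤ ‖x - y‖ := by
  have a := h1 q hq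
  have b := h2 p hp
  have c : ‖p - q‖ ^ 2 ≤ inner ℝ (x - y) (p - q) := by
    have e1 : inner ℝ (x - p) (q - p) = - inner ℝ (x - p) (p - q) := by
      rw [← inner_neg_right, neg_sub]
    have e2 : inner ℝ (x - y) (p - q) =
        inner ℝ (x - p) (p - q) - inner ℝ (y - q) (p - q) + ‖p - q‖ ^ 2 := by
      rw [← real_inner_self_eq_norm_sq, ← inner_sub_left, ← inner_add_left]
      congr 1
      abel
    linarith
  have d := real_inner_le_norm (x - y) (p - q)
  by_contra! hlt
  nlinarith [norm_nonneg (x - y), norm_nonneg (p - q)]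

/-- Serves the measurability of the iterates and of the exact projected step. -/
theorem euclProj_lipschitz [CompleteSpace E] {K : Set E} (hc : IsClosed K) (hK : Convex ℝ K)
    (hne : K.Nonempty) : LipschitzWith 1 (euclProj K) :=
  LipschitzWith.of_dist_le_mul fun x y => by
    have hx := euclProj_spec hc hK hne x
    have hy := euclProj_spec hc hK hne y
    simpa [dist_eq_norm] using norm_sub_le_of_variational hx.1 hy.1 hx.2 hy.2

end EuclProj

/-! ### A Gaussian Poincaré inequality for odd Lipschitz functions. -/

section GaussianPoincare
variable {E : Type*} [NormedAddCommGroup E] [InnerProductSpace ℝ E] [FiniteDimensional ℝ E]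
  [MeasurableSpace E] [BorelSpace E]

/-- The standard Gaussian measure has a density proportional to `exp (-‖x‖² / 2)`. -/
theorem stdGaussian_eq_withDensity :
    stdGaussian E = volume.withDensity
      (fun x => ENNReal.ofReal ((∫ y : E, Real.exp (-‖y‖ ^ 2 / 2))⁻¹ * Real.exp (-‖x‖ ^ 2 / 2))) := by
  have hint : Integrable (fun y : E => Real.exp (-‖y‖ ^ 2 / 2)) := by
    have := (GaussianFourier.integrable_cexp_neg_mul_sq_norm_add (V := E) (b := 1 / 2)
      (by norm_num) 0 0).norm
    refine this.congr (Eventually.of_forall fun y => ?_)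
    simp only [Complex.norm_exp]
    congr 1
    simp [← Complex.ofReal_pow]
    norm_num
    ring
  set Z := ∫ y : E, Real.exp (-‖y‖ ^ 2 / 2) with hZ
  have hZc : (Z : ℂ) = (Real.pi / (1 / 2 : ℂ)) ^ (Module.finrank ℝ E / 2 : ℂ) := by
    have := GaussianFourier.integral_cexp_neg_mul_sq_norm_add (V := E) (b := 1 / 2)
      (by norm_num) 0 0
    rw [hZ, ← integral_complex_ofReal]
    refine Eq.trans (integral_congr_ae (Eventually.of_forall fun y => ?_)) (this.trans ?_)
    · simp only [Complex.ofReal_exp]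
      congr 1
      push_cast
      ring
    · simp
  have hZpos : 0 < Z := by
    refine integral_pos_of_integrable_nonneg_nonzero (x := 0) (by fun_prop) hint
      (fun _ => (Real.exp_pos _).le) (Real.exp_pos _).ne'
  have hfin : IsFiniteMeasure (volume.withDensity
      (fun x : E => ENNReal.ofReal (Z⁻¹ * Real.exp (-‖x‖ ^ 2 / 2)))) :=
    isFiniteMeasure_withDensity_ofReal (hint.const_mul _).2
  -- Finite measures are determined by their characteristic functions. The prefactor of the Gaussian
  -- Fourier integral is exactly the normalization `Z`, so it cancels.
  refine Measure.ext_of_charFun ?_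
  ext t
  rw [charFun_stdGaussian, charFun_apply, integral_withDensity_eq_integral_toReal_smul
    (by fun_prop) (by simp)]
  have hg := GaussianFourier.integral_cexp_neg_mul_sq_norm_add (V := E) (b := 1 / 2)
      (by norm_num) Complex.I t
  rw [← hZc] at hg
  have hZ0 : (Z : ℂ) ≠ 0 := by exact_mod_cast hZpos.ne'
  have : ∀ x : E, (ENNReal.ofReal (Z⁻¹ * Real.exp (-‖x‖ ^ 2 / 2))).toReal •
      Complex.exp (inner ℝ x t * Complex.I) =
      (Z : ℂ)⁻¹ * Complex.exp (-(1 / 2 : ℂ) * ‖x‖ ^ 2 + Complex.I * inner ℝ t x) := by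
    intro x
    rw [ENNReal.toReal_ofReal (by positivity), Complex.exp_add, Complex.real_smul,
      real_inner_comm]
    push_cast
    rw [mul_assoc]
    congr 3
    · ring
    · ring
  simp_rw [this]
  rw [integral_const_mul, hg, ← mul_assoc, inv_mul_cancel₀ hZ0, one_mul]
  congr 1
  rw [Complex.I_sq]
  ring

/-- Carries Rademacher's theorem over from Lebesgue to Gaussian measure. -/
theorem stdGaussian_absolutelyContinuous : stdGaussian E ≪ volume := by
  rw [stdGaussian_eq_withDensity]
  exact withDensity_absolutelyContinuous _ _

theorem integral_inner_sq_stdGaussian (a : E) :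
    ∫ y, (inner ℝ a y) ^ 2 ∂(stdGaussian E) = ‖a‖ ^ 2 := by
  have h := variance_dual_stdGaussian (innerSL ℝ a)
  rw [variance_of_integral_eq_zero (by fun_prop) (integral_strongDual_stdGaussian _)] at h
  simpa using h

theorem integral_norm_sq_stdGaussian :
    ∫ y, ‖y‖ ^ 2 ∂(stdGaussian E) = Module.finrank ℝ E := by
  let b := stdOrthonormalBasis ℝ E
  have : ∀ y : E, ‖y‖ ^ 2 = ∑ i, (inner ℝ (b i) y) ^ 2 := fun y => by
    simpa using (b.sum_sq_norm_inner_right y).symm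
  simp_rw [this]
  rw [integral_finsetSum]
  · simp [integral_inner_sq_stdGaussian]
  · intro i _
    have : MemLp (fun y => innerSL ℝ (b i) y) 2 (stdGaussian E) :=
      IsGaussian.memLp_dual _ _ _ (by simp)
    simpa using this.integrable_sq

/-- The Maurey–Pisier form of the Gaussian Poincaré inequality, for odd functions. -/
theorem integral_sq_le_of_lipschitz_of_odd {K : ℝ≥0} {f : E → ℝ} (hf : LipschitzWith K f)
    (hodd : ∀ x, f (-x) = -f x) :
    4 * ∫ x, f x ^ 2 ∂(stdGaussian E) ≤ Real.pi ^ 2 * K ^ 2 := by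
  set γ := stdGaussian E
  have hid : MemLp (id : E → E) 2 γ := IsGaussian.memLp_id _ _ (by simp)
  have hf0 : f 0 = 0 := by have := hodd 0; simp at this; linarith
  have hfL2 : MemLp f 2 γ := by
    refine MemLp.of_le_mul (c := K) hid hf.continuous.aestronglyMeasurable
      (Eventually.of_forall fun x => ?_)
    simpa [hf0, dist_eq_norm] using hf.dist_le_mul x 0
  have hfx : MemLp (fun p : E × E => p.1) 2 (γ.prod γ) := hid.comp_fst γ
  have hfy : MemLp (fun p : E × E => p.2) 2 (γ.prod γ) := hid.comp_snd γ
  have hinv : ∀ θ, MeasurePreserving (ContinuousLinearMap.rotation θ : E × E → E × E)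
      (γ.prod γ) (γ.prod γ) := fun θ =>
    ⟨by fun_prop, IsGaussian.map_rotation_eq_self (by simpa using integral_id_stdGaussian) θ⟩
  have hrot : ∀ c s : ℝ, MemLp (fun p : E × E => f (c • p.1 + s • p.2)) 2 (γ.prod γ) := by
    intro c s
    refine MemLp.of_le_mul (c := K) ((hfx.const_smul c).add (hfy.const_smul s))
      (hf.continuous.comp (by fun_prop)).aestronglyMeasurable
      (Eventually.of_forall fun p => ?_)
    simpa [hf0, dist_eq_norm] using hf.dist_le_mul (c • p.1 + s • p.2) 0
  -- For independent Gaussians $X,Y$ the path $\cos\theta\,X+\sin\theta\,Y$ runs from $X$ at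
  -- $\theta=0$ to $-X$ at $\theta=\pi$; `d δ` is the increment of `f` over its first angle `δ`.
  let d : ℝ → E × E → ℝ := fun δ p => f (Real.cos δ • p.1 + Real.sin δ • p.2) - f p.1
  have hd : ∀ δ, MemLp (d δ) 2 (γ.prod γ) := fun δ => by
    have := (hrot (Real.cos δ) (Real.sin δ)).sub (hrot 1 0)
    simpa [d, Pi.sub_def] using this
  -- Cut the path into `m` equal arcs. By oddness the increments sum to $-2f(X)$. Cauchy–Schwarz
  -- costs a factor `m`, and rotation invariance of the Gaussian pair makes the `m` mean squares
  -- equal, hence $m^2$ in all.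
  have hchain : ∀ m : ℕ, 0 < m →
      4 * ∫ x, f x ^ 2 ∂γ ≤ ∫ p, (m * d (Real.pi / m) p) ^ 2 ∂(γ.prod γ) := by
    intro m hm
    set δ := Real.pi / m with hδ
    have hm' : (m : ℝ) ≠ 0 := by positivity
    have hpt : ∀ p : E × E, 4 * f p.1 ^ 2 ≤
        ∑ j ∈ Finset.range m, m * (d δ (ContinuousLinearMap.rotation (j * δ) p)) ^ 2 := by
      intro p
      have hstep : ∀ j : ℕ, d δ (ContinuousLinearMap.rotation (j * δ) p) =
          f (Real.cos ((j + 1 : ℕ) * δ) • p.1 + Real.sin ((j + 1 : ℕ) * δ) • p.2) -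
          f (Real.cos (j * δ) • p.1 + Real.sin (j * δ) • p.2) := by
        intro j
        simp only [d, ContinuousLinearMap.rotation_apply]
        congr 2
        push_cast
        rw [add_mul, one_mul, Real.cos_add, Real.sin_add]
        module
      have htel : ∑ j ∈ Finset.range m, d δ (ContinuousLinearMap.rotation (j * δ) p) =
          - (2 * f p.1) := by
        rw [Finset.sum_congr rfl fun j _ => hstep j, Finset.sum_range_sub
          (fun j : ℕ => f (Real.cos (j * δ) • p.1 + Real.sin (j * δ) • p.2))]
        rw [hδ, mul_div_cancel₀ _ hm']
        simp [hodd]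
        ring
      have hcs := sq_sum_le_card_mul_sum_sq (s := Finset.range m)
        (f := fun j : ℕ => d δ (ContinuousLinearMap.rotation (j * δ) p))
      rw [htel, Finset.card_range] at hcs
      rw [← Finset.mul_sum]
      linarith [hcs]
    have hint : ∀ j ∈ Finset.range m, Integrable (fun p : E × E =>
        m * (d δ (ContinuousLinearMap.rotation (j * δ) p)) ^ 2) (γ.prod γ) := fun j _ =>
      (((hd δ).comp_measurePreserving (hinv (j * δ))).integrable_sq).const_mul _
    have h1 : 4 * ∫ x, f x ^ 2 ∂γ = ∫ p : E × E, 4 * f p.1 ^ 2 ∂(γ.prod γ) := by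
      rw [integral_const_mul, integral_fun_fst (fun x => f x ^ 2)]
      simp
    rw [h1]
    refine (integral_mono ?_ (integrable_finsetSum _ hint) hpt).trans_eq ?_
    · have := (hrot 1 0).integrable_sq.const_mul 4
      simpa using this
    rw [integral_finsetSum _ hint]
    have h2 : ∀ j ∈ Finset.range m, ∫ p : E × E,
        m * (d δ (ContinuousLinearMap.rotation (j * δ) p)) ^ 2 ∂(γ.prod γ) =
        m * ∫ p, (d δ p) ^ 2 ∂(γ.prod γ) := by
      intro j _
      rw [integral_const_mul]
      congr 1
      have hmap := integral_map (f := fun p => (d δ p) ^ 2) (hinv (j * δ)).measurable.aemeasurable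
        (by rw [(hinv (j * δ)).map_eq]; exact (hd δ).integrable_sq.aestronglyMeasurable)
      rw [(hinv (j * δ)).map_eq] at hmap
      exact hmap.symm
    rw [Finset.sum_congr rfl h2, Finset.sum_const, Finset.card_range]
    simp_rw [mul_pow]
    rw [integral_const_mul]
    simp
    ring
  -- Only the increment at $\theta=0$ is left, so differentiability is needed at $X$ alone, where it
  -- holds almost surely.
  have hdiff : ∀ᵐ p ∂(γ.prod γ), Tendsto (fun m : ℕ => ((m : ℝ) * d (Real.pi / m) p) ^ 2) atTop
      (𝓝 ((Real.pi * fderiv ℝ f p.1 p.2) ^ 2)) := by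
    have hae : ∀ᵐ x ∂γ, DifferentiableAt ℝ f x :=
      stdGaussian_absolutelyContinuous.ae_le (hf.ae_differentiableAt)
    filter_upwards [Measure.quasiMeasurePreserving_fst.ae hae] with p hp
    have hcurve : HasDerivAt (fun t : ℝ => Real.cos t • p.1 + Real.sin t • p.2) p.2 0 := by
      have := ((Real.hasDerivAt_cos 0).smul_const p.1).add ((Real.hasDerivAt_sin 0).smul_const p.2)
      simpa [Pi.add_def] using this
    have hp' : HasFDerivAt f (fderiv ℝ f p.1)
        ((fun t : ℝ => Real.cos t • p.1 + Real.sin t • p.2) 0) := by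
      simpa using hp.hasFDerivAt
    have hder := hp'.comp_hasDerivAt (0 : ℝ) hcurve
    have hsl := hder.tendsto_slope_zero
    have hseq : Tendsto (fun m : ℕ => Real.pi / (m : ℝ)) atTop (𝓝[≠] 0) := by
      refine tendsto_nhdsWithin_iff.2 ⟨tendsto_const_div_atTop_nhds_zero_nat _, ?_⟩
      filter_upwards [eventually_gt_atTop 0] with m hm
      have : (0 : ℝ) < Real.pi / m := by positivity
      exact this.ne'
    have := ((hsl.comp hseq).const_mul Real.pi).pow 2
    refine this.congr' ?_
    filter_upwards [eventually_gt_atTop 0] with m hm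
    have hm' : (m : ℝ) ≠ 0 := by positivity
    simp [d]
    field_simp
  -- Since $m\cdot\pi/m=\pi$, the majorant does not depend on `m`.
  have hbound : ∀ m : ℕ, ∀ p : E × E,
      ‖((m : ℝ) * d (Real.pi / m) p) ^ 2‖ ≤ (Real.pi * K * (‖p.1‖ + ‖p.2‖)) ^ 2 := by
    intro m p
    rw [norm_pow]
    refine pow_le_pow_left₀ (norm_nonneg _) ?_ 2
    rcases Nat.eq_zero_or_pos m with rfl | hm
    · simp
      positivity
    set δ := Real.pi / m with hδ
    have hδ0 : 0 ≤ δ := by positivity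
    have h1 : ‖d δ p‖ ≤ K * (δ * (‖p.1‖ + ‖p.2‖)) := by
      have := hf.dist_le_mul (Real.cos δ • p.1 + Real.sin δ • p.2) p.1
      rw [dist_eq_norm, dist_eq_norm] at this
      refine this.trans ?_
      gcongr
      have h2 : Real.cos δ • p.1 + Real.sin δ • p.2 - p.1 =
          (Real.cos δ - Real.cos 0) • p.1 + (Real.sin δ) • p.2 := by
        simp only [Real.cos_zero]; module
      rw [h2]
      refine (norm_add_le _ _).trans ?_
      rw [norm_smul, norm_smul, mul_add]
      have hc : |Real.cos δ - Real.cos 0| ≤ δ := by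
        have := Real.abs_cos_sub_cos_le δ 0
        simpa [abs_of_nonneg hδ0] using this
      have hs : |Real.sin δ| ≤ δ := by
        simpa [abs_of_nonneg hδ0] using Real.abs_sin_sub_sin_le δ 0
      gcongr
      · exact hc
      · exact hs
    rw [norm_mul, Real.norm_natCast]
    calc (m : ℝ) * ‖d δ p‖ ≤ m * (K * (δ * (‖p.1‖ + ‖p.2‖))) := by gcongr
      _ = (m * δ) * K * (‖p.1‖ + ‖p.2‖) := by ring
      _ = _ := by rw [hδ, mul_div_cancel₀ _ (by positivity)]
  have hlim := tendsto_integral_of_dominated_convergence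
    (fun p : E × E => (Real.pi * K * (‖p.1‖ + ‖p.2‖)) ^ 2)
    (fun m : ℕ => (((hd (Real.pi / m)).const_mul (m : ℝ)).integrable_sq).aestronglyMeasurable)
    (((hfx.norm.add hfy.norm).const_mul (Real.pi * K)).integrable_sq)
    (fun m => Eventually.of_forall (hbound m)) hdiff
  have hle : 4 * ∫ x, f x ^ 2 ∂γ ≤ ∫ p : E × E, (Real.pi * fderiv ℝ f p.1 p.2) ^ 2 ∂(γ.prod γ) :=
    ge_of_tendsto hlim ((eventually_gt_atTop 0).mono fun m hm => hchain m hm)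
  refine hle.trans ?_
  have hdom : Integrable (fun p : E × E => (Real.pi * fderiv ℝ f p.1 p.2) ^ 2) (γ.prod γ) := by
    refine Integrable.mono' ((hfy.norm.const_mul (Real.pi * K)).integrable_sq) ?_
      (Eventually.of_forall fun p => ?_)
    · have hm : Measurable (fun p : E × E => fderiv ℝ f p.1 p.2) := by
        have := (measurable_fderiv ℝ f).comp (measurable_fst : Measurable (Prod.fst : E × E → E))
        exact (isBoundedBilinearMap_apply.continuous.measurable.comp
          (this.prodMk measurable_snd))
      exact ((hm.const_mul _).pow_const 2).aestronglyMeasurable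
    · rw [norm_pow, Real.norm_eq_abs]
      refine pow_le_pow_left₀ (abs_nonneg _) ?_ 2
      rw [abs_mul, abs_of_pos Real.pi_pos, mul_assoc]
      gcongr
      rw [← Real.norm_eq_abs]
      exact (ContinuousLinearMap.le_opNorm _ _).trans
        (by gcongr; exact norm_fderiv_le_of_lipschitz ℝ hf)
  rw [integral_prod _ hdom]
  -- For fixed `x`, the linear form $y\mapsto Df(x)y$ has Gaussian second moment $\|Df(x)\|^2\le
  -- K^2$.
  have hin : ∀ x, ∫ y, (Real.pi * fderiv ℝ f x y) ^ 2 ∂γ ≤ Real.pi ^ 2 * K ^ 2 := by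
    intro x
    simp_rw [mul_pow]
    rw [integral_const_mul]
    gcongr
    have h := integral_inner_sq_stdGaussian ((InnerProductSpace.toDual ℝ E).symm (fderiv ℝ f x))
    simp only [InnerProductSpace.toDual_symm_apply, LinearIsometryEquiv.norm_map] at h
    rw [h]
    gcongr
    exact norm_fderiv_le_of_lipschitz ℝ hf
  refine (integral_mono hdom.integral_prod_left (integrable_const _) hin).trans ?_
  simp

end GaussianPoincare

/-! ### Polar coordinates. -/

section Polar
variable {E : Type*} [NormedAddCommGroup E] [NormedSpace ℝ E] [FiniteDimensional ℝ E]
  [MeasurableSpace E] [BorelSpace E] [Nontrivial E]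

/-- Polar coordinates for a product of a radial function and a function of the direction. -/
theorem integral_radial_mul_direction (μ : Measure E) [μ.IsAddHaarMeasure] (φ : ℝ → ℝ) (ψ : E → ℝ) :
    ∫ x, φ ‖x‖ * ψ (‖x‖⁻¹ • x) ∂μ =
      (∫ ω, ψ (ω : E) ∂μ.toSphere) * ∫ r in Ioi (0 : ℝ), r ^ (Module.finrank ℝ E - 1) * φ r :=
  calc
    ∫ x, φ ‖x‖ * ψ (‖x‖⁻¹ • x) ∂μ
      = ∫ x : ({(0)}ᶜ : Set E), φ ‖x.1‖ * ψ (‖x.1‖⁻¹ • x.1) ∂(μ.comap (↑)) := by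
      rw [integral_subtype_comap (measurableSet_singleton _).compl
        fun x ↦ φ ‖x‖ * ψ (‖x‖⁻¹ • x), restrict_compl_singleton]
    _ = ∫ x, ψ x.1 * φ x.2 ∂μ.toSphere.prod (.volumeIoiPow (Module.finrank ℝ E - 1)) := by
      have := μ.measurePreserving_homeomorphUnitSphereProd.integral_comp
        (Homeomorph.measurableEmbedding _)
        (fun p : Metric.sphere (0 : E) 1 × Ioi (0 : ℝ) => ψ p.1 * φ p.2)
      rw [← this]
      refine integral_congr_ae (Eventually.of_forall fun x => ?_)
      simp [mul_comm]
    _ = (∫ ω, ψ (ω : E) ∂μ.toSphere) *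
        ∫ x : Ioi (0 : ℝ), φ x ∂.volumeIoiPow (Module.finrank ℝ E - 1) :=
      integral_prod_mul (fun ω : Metric.sphere (0 : E) 1 => ψ ω) (fun r : Ioi (0 : ℝ) => φ r)
    _ = _ := by
      congr 1
      simp only [Measure.volumeIoiPow, ENNReal.ofReal]
      rw [integral_withDensity_eq_integral_smul,
        integral_subtype_comap measurableSet_Ioi
          fun a ↦ Real.toNNReal (a ^ (Module.finrank ℝ E - 1)) • φ a,
        setIntegral_congr_fun measurableSet_Ioi fun x hx ↦ ?_]
      · rw [NNReal.smul_def, Real.coe_toNNReal _ (pow_nonneg hx.out.le _), smul_eq_mul]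
      · exact (measurable_subtype_coe.pow_const _).real_toNNReal

end Polar

/-! ### From Gaussian measure to the unit sphere. -/

section Sphere
variable {E : Type*} [NormedAddCommGroup E] [InnerProductSpace ℝ E] [FiniteDimensional ℝ E]
  [MeasurableSpace E] [BorelSpace E] [Nontrivial E]

theorem toSphere_univ_toReal_pos :
    0 < ((volume : Measure E).toSphere).real univ := by
  rw [measureReal_def, ENNReal.toReal_pos_iff, pos_iff_ne_zero]
  exact ⟨Measure.measure_univ_ne_zero.2 (Measure.toSphere_ne_zero _), measure_lt_top _ _⟩

/-- The second moment of the `1`-homogeneous extension of `F` under the Gaussian measure. -/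
theorem integral_homogeneous_sq_stdGaussian (F : E → ℝ) :
    (∫ x, (‖x‖ * F (‖x‖⁻¹ • x)) ^ 2 ∂(stdGaussian E)) * ((volume : Measure E).toSphere).real univ =
      Module.finrank ℝ E * ∫ ω, F (ω : E) ^ 2 ∂(volume : Measure E).toSphere := by
  -- The density is radial, so the integral is the sphere integral of `G` times a constant. Taking
  -- `G = 1`, where the Gaussian side is the dimension, identifies that constant without evaluating
  -- the radial integral.
  obtain ⟨A, hA⟩ : ∃ A : ℝ, ∀ G : E → ℝ, ∫ x, ‖x‖ ^ 2 * G (‖x‖⁻¹ • x) ∂(stdGaussian E) =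
      (∫ ω, G (ω : E) ∂(volume : Measure E).toSphere) * A := by
    refine ⟨∫ r in Ioi (0 : ℝ), r ^ (Module.finrank ℝ E - 1) * ((ENNReal.ofReal
      ((∫ y : E, Real.exp (-‖y‖ ^ 2 / 2))⁻¹ * Real.exp (-r ^ 2 / 2))).toReal * r ^ 2),
      fun G => ?_⟩
    rw [stdGaussian_eq_withDensity, integral_withDensity_eq_integral_toReal_smul
      (by fun_prop) (by simp), ← integral_radial_mul_direction volume (fun r =>
        (ENNReal.ofReal ((∫ y : E, Real.exp (-‖y‖ ^ 2 / 2))⁻¹ * Real.exp (-r ^ 2 / 2))).toReal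
          * r ^ 2) G]
    simp [mul_assoc]
  have h1 := hA (fun _ => 1)
  have h2 := hA (fun x => F x ^ 2)
  simp only [mul_one, integral_norm_sq_stdGaussian, integral_const, smul_eq_mul] at h1
  simp_rw [mul_pow]
  rw [h2, h1]
  ring

omit [FiniteDimensional ℝ E] [MeasurableSpace E] [BorelSpace E] [Nontrivial E] in
/-- The `1`-homogeneous extension of an odd function which is Lipschitz on the unit sphere. -/
theorem lipschitzWith_homogeneous {K : ℝ≥0} {F : E → ℝ}
    (hF : ∀ x y, ‖x‖ = 1 → ‖y‖ = 1 → |F x - F y| ≤ K * ‖x - y‖) (hodd : ∀ x, F (-x) = - F x) :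
    LipschitzWith (3 * K) (fun x => ‖x‖ * F (‖x‖⁻¹ • x)) := by
  have hunit : ∀ x : E, x ≠ 0 → ‖‖x‖⁻¹ • x‖ = 1 := fun x hx => by
    rw [norm_smul, norm_inv, norm_norm, inv_mul_cancel₀ (norm_ne_zero_iff.2 hx)]
  -- Oddness gives $2|F(x)|=|F(x)-F(-x)|\le 2K$.
  have hbd : ∀ x : E, ‖x‖ = 1 → |F x| ≤ K := fun x hx => by
    have h := hF x (-x) hx (by simpa using hx)
    rw [hodd, sub_neg_eq_add, sub_neg_eq_add, ← two_mul, ← two_smul ℝ x, norm_smul, hx, abs_mul,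
      abs_two, Real.norm_eq_abs, abs_two] at h
    linarith
  refine LipschitzWith.of_dist_le_mul fun x y => ?_
  rw [Real.dist_eq, dist_eq_norm]
  push_cast
  have hK : (0 : ℝ) ≤ K := K.2
  rcases eq_or_ne x 0 with rfl | hx
  · rcases eq_or_ne y 0 with rfl | hy
    · simp
    · have := hbd _ (hunit y hy)
      simp only [norm_zero, zero_mul, zero_sub, abs_neg, norm_neg, abs_mul, abs_norm]
      nlinarith [norm_nonneg y, mul_nonneg hK (norm_nonneg y)]
  rcases eq_or_ne y 0 with rfl | hy
  · have := hbd _ (hunit x hx)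
    simp only [norm_zero, zero_mul, sub_zero, abs_mul, abs_norm]
    nlinarith [norm_nonneg x, mul_nonneg hK (norm_nonneg x)]
  have h1 : |‖x‖ - ‖y‖| ≤ ‖x - y‖ := abs_norm_sub_norm_le x y
  -- Changing the norm costs `K`, by the bound on $|F|$; changing the direction costs `2K`, by this
  -- estimate. Together they give `3K`.
  have h2 : ‖y‖ * ‖‖x‖⁻¹ • x - ‖y‖⁻¹ • y‖ ≤ 2 * ‖x - y‖ := by
    have e : ‖y‖ • (‖x‖⁻¹ • x - ‖y‖⁻¹ • y) = (‖y‖ - ‖x‖) • (‖x‖⁻¹ • x) + (x - y) := by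
      rw [smul_sub, smul_smul ‖y‖ ‖y‖⁻¹, mul_inv_cancel₀ (norm_ne_zero_iff.2 hy), sub_smul,
        smul_smul ‖x‖ ‖x‖⁻¹, mul_inv_cancel₀ (norm_ne_zero_iff.2 hx)]
      module
    calc ‖y‖ * ‖‖x‖⁻¹ • x - ‖y‖⁻¹ • y‖ = ‖‖y‖ • (‖x‖⁻¹ • x - ‖y‖⁻¹ • y)‖ := by
          rw [norm_smul, norm_norm]
      _ ≤ |‖y‖ - ‖x‖| * 1 + ‖x - y‖ := by
          rw [e]
          refine (norm_add_le _ _).trans ?_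
          rw [norm_smul _ (‖x‖⁻¹ • x), hunit x hx, Real.norm_eq_abs]
      _ ≤ _ := by rw [abs_sub_comm]; linarith
  have e : ‖x‖ * F (‖x‖⁻¹ • x) - ‖y‖ * F (‖y‖⁻¹ • y) =
      (‖x‖ - ‖y‖) * F (‖x‖⁻¹ • x) + ‖y‖ * (F (‖x‖⁻¹ • x) - F (‖y‖⁻¹ • y)) := by ring
  rw [e]
  refine (abs_add_le _ _).trans ?_
  rw [abs_mul, abs_mul, abs_norm]
  have h3 := hF _ _ (hunit x hx) (hunit y hy)
  calc |‖x‖ - ‖y‖| * |F (‖x‖⁻¹ • x)| + ‖y‖ * |F (‖x‖⁻¹ • x) - F (‖y‖⁻¹ • y)|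
      ≤ ‖x - y‖ * K + ‖y‖ * (K * ‖‖x‖⁻¹ • x - ‖y‖⁻¹ • y‖) := by
        gcongr
        exact hbd _ (hunit x hx)
    _ = ‖x - y‖ * K + K * (‖y‖ * ‖‖x‖⁻¹ • x - ‖y‖⁻¹ • y‖) := by ring
    _ ≤ ‖x - y‖ * K + K * (2 * ‖x - y‖) := by gcongr
    _ = _ := by ring

/-- A Poincaré inequality for odd Lipschitz functions on the unit sphere. -/
theorem integral_sq_toSphere_le {K : ℝ≥0} {F : E → ℝ}
    (hF : ∀ x y, ‖x‖ = 1 → ‖y‖ = 1 → |F x - F y| ≤ K * ‖x - y‖) (hodd : ∀ x, F (-x) = - F x) :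
    4 * Module.finrank ℝ E * ∫ ω, F (ω : E) ^ 2 ∂(volume : Measure E).toSphere ≤
      9 * Real.pi ^ 2 * K ^ 2 * ((volume : Measure E).toSphere).real univ := by
  -- The 9 is the square of the factor 3 lost in the homogeneous extension.
  have h := integral_sq_le_of_lipschitz_of_odd (lipschitzWith_homogeneous hF hodd)
    (fun x => by simp [hodd])
  have e := integral_homogeneous_sq_stdGaussian F
  have hp := toSphere_univ_toReal_pos (E := E)
  push_cast at h
  rw [mul_assoc, ← e]
  nlinarith

end Sphere

/-! ### The uniform law on the sphere of radius `η`. -/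

section SphereUniform

variable {d : ℕ}

theorem integral_sphereUniform {F : Type*} [NormedAddCommGroup F] [NormedSpace ℝ F] {η : ℝ}
    (hη : 0 < η) (g : Strat d → F) :
    ∫ v, g v ∂(sphereUniform d η) =
      ((volume : Measure (Strat d)).toSphere.real univ)⁻¹ •
        ∫ ω, g (η • (ω : Strat d)) ∂(volume : Measure (Strat d)).toSphere := by
  have hemb : MeasurableEmbedding (fun u : Metric.sphere (0 : Strat d) 1 => η • (u : Strat d)) :=
    (measurableEmbedding_const_smul₀ hη.ne').comp
      (MeasurableEmbedding.subtype_coe Metric.isClosed_sphere.measurableSet)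
  rw [sphereUniform, hemb.integral_map, integral_smul_measure, ENNReal.toReal_inv]
  rfl

theorem isProbabilityMeasure_sphereUniform (hd : 0 < d) (η : ℝ) :
    IsProbabilityMeasure (sphereUniform d η) := by
  have : Nonempty (Fin d) := ⟨⟨0, hd⟩⟩
  have : IsProbabilityMeasure (((volume : Measure (Strat d)).toSphere univ)⁻¹ •
      (volume : Measure (Strat d)).toSphere) := ⟨by
    rw [Measure.smul_apply, smul_eq_mul, ENNReal.inv_mul_cancel
      (Measure.measure_univ_ne_zero.2 (Measure.toSphere_ne_zero _)) (measure_ne_top _ _)]⟩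
  exact Measure.isProbabilityMeasure_map (by fun_prop)

theorem ae_norm_eq_sphereUniform {η : ℝ} (hη : 0 < η) :
    ∀ᵐ v ∂(sphereUniform d η), ‖v‖ = η := by
  rw [sphereUniform, ae_map_iff (by fun_prop) (measurableSet_eq_fun (by fun_prop) (by fun_prop))]
  refine Eventually.of_forall fun u => ?_
  simp [norm_smul, abs_of_pos hη]

/-- The mean squared symmetric difference of a Lipschitz function over a sphere. -/
theorem integral_sq_sub_sphereUniform_le (hd : 0 < d) {η : ℝ} (hη : 0 < η) {L : ℝ≥0}
    {h : Strat d → ℝ} (hh : LipschitzWith L h) (x : Strat d) :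
    ∫ v, (h (x + v) - h (x - v)) ^ 2 ∂(sphereUniform d η) ≤ 9 * Real.pi ^ 2 * L ^ 2 * η ^ 2 / d := by
  have : Nonempty (Fin d) := ⟨⟨0, hd⟩⟩
  have hp := toSphere_univ_toReal_pos (E := Strat d)
  -- The symmetric difference is odd in `u` and $2L\eta$-Lipschitz; the 4 in $(2L\eta)^2$ cancels
  -- the 4 of the sphere inequality.
  have hF : ∀ u w : Strat d, ‖u‖ = 1 → ‖w‖ = 1 →
      |(h (x + η • u) - h (x - η • u)) - (h (x + η • w) - h (x - η • w))| ≤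
        ((2 * L * η.toNNReal : ℝ≥0) : ℝ) * ‖u - w‖ := by
    intro u w _ _
    have h1 := hh.dist_le_mul (x + η • u) (x + η • w)
    have h2 := hh.dist_le_mul (x - η • u) (x - η • w)
    rw [Real.dist_eq, dist_add_left, dist_smul₀, Real.norm_of_nonneg hη.le, dist_eq_norm] at h1
    rw [Real.dist_eq, dist_sub_left, dist_smul₀, Real.norm_of_nonneg hη.le, dist_eq_norm] at h2
    rw [abs_le] at *
    push_cast [Real.coe_toNNReal η hη.le]
    constructor <;> linarith
  have := integral_sq_toSphere_le hF (fun u => by simp [sub_eq_add_neg])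
  rw [integral_sphereUniform hη, smul_eq_mul, inv_mul_le_iff₀ hp, ← mul_div_assoc,
    le_div_iff₀ (by positivity)]
  simp only [finrank_euclideanSpace, Fintype.card_fin] at this
  push_cast [Real.coe_toNNReal η hη.le] at this
  linarith

end SphereUniform

/-! ### Radial cut-off functions. -/

section Cutoff
variable {E : Type*} [NormedAddCommGroup E]

/-- A radial Lipschitz cut-off, equal to `1` on the ball of radius `1 - 1 / k` and to `0` outside the
unit ball. -/
noncomputable def ballCutoff (k : ℕ) (z : E) : ℝ := max 0 (min 1 (k * (1 - ‖z‖)))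

theorem lipschitzWith_ballCutoff (k : ℕ) : LipschitzWith k (ballCutoff k : E → ℝ) := by
  have : LipschitzWith k (fun z : E => (k : ℝ) * (1 - ‖z‖)) := LipschitzWith.of_dist_le_mul fun x y => by
    rw [Real.dist_eq, ← mul_sub, abs_mul, sub_sub_sub_cancel_left, Nat.abs_cast, dist_eq_norm,
      norm_sub_rev]
    simp only [NNReal.coe_natCast]
    gcongr
    exact abs_norm_sub_norm_le _ _
  exact (this.const_min 1).const_max 0

theorem ballCutoff_eq_zero (k : ℕ) {z : E} (hz : 1 ≤ ‖z‖) : ballCutoff k z = 0 := by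
  have : (k : ℝ) * (1 - ‖z‖) ≤ 0 := mul_nonpos_of_nonneg_of_nonpos (by positivity) (by linarith)
  simp [ballCutoff, this]

theorem hasCompactSupport_ballCutoff [ProperSpace E] (k : ℕ) : HasCompactSupport (ballCutoff k : E → ℝ) := by
  refine HasCompactSupport.intro (isCompact_closedBall (0 : E) 1) fun z hz => ?_
  refine ballCutoff_eq_zero k ?_
  simp at hz
  exact hz.le

end Cutoff

/-! ### The divergence theorem on the unit ball for Lipschitz functions. -/

section Divergence
variable {E : Type*} [NormedAddCommGroup E] [InnerProductSpace ℝ E] [FiniteDimensional ℝ E]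
  [MeasurableSpace E] [BorelSpace E] [Nontrivial E]

/-- The cut-off has radial slope $-k$ in the shell and is constant on either side; the two bounding
spheres and the origin are null. The direction `-e`, which integration by parts produces, absorbs
the sign. -/
theorem ae_lineDeriv_ballCutoff (k : ℕ) (hk : 0 < k) (e : E) :
    ∀ᵐ z : E, lineDeriv ℝ (ballCutoff k : E → ℝ) z (-e) =
      (Ioo (1 - 1 / k : ℝ) 1).indicator (fun _ => (k : ℝ)) ‖z‖ * inner ℝ (‖z‖⁻¹ • z) e := by
  have hk' : (0 : ℝ) < k := by positivity
  have hae : ∀ c : ℝ, ∀ᵐ z : E, ‖z‖ ≠ c := fun c => by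
    have := Measure.addHaar_sphere (volume : Measure E) 0 c
    filter_upwards [measure_eq_zero_iff_ae_notMem.1 this] with z hz
    simpa using hz
  filter_upwards [hae 1, hae (1 - 1 / k), hae 0] with z h1 h2 h0
  rcases lt_or_gt_of_ne h1 with h1 | h1
  · rcases lt_or_gt_of_ne h2 with h2 | h2
    · rw [indicator_of_notMem (by simp only [mem_Ioo, not_and]; intro h; linarith), zero_mul]
      have hev : (ballCutoff k : E → ℝ) =ᶠ[𝓝 z] fun _ => 1 := by
        filter_upwards [continuous_norm.continuousAt.eventually_lt continuousAt_const h2] with y hy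
        have : 1 ≤ (k : ℝ) * (1 - ‖y‖) := by
          rw [lt_sub_comm, div_lt_iff₀ hk'] at hy
          linarith
        simp [ballCutoff, this]
      rw [hev.lineDeriv_eq]
      simp [lineDeriv]
    · rw [indicator_of_mem (by exact ⟨h2, h1⟩)]
      have hev : (ballCutoff k : E → ℝ) =ᶠ[𝓝 z] fun y => k * (1 - ‖y‖) := by
        filter_upwards [continuous_norm.continuousAt.eventually_lt continuousAt_const h1,
          continuousAt_const.eventually_lt continuous_norm.continuousAt h2] with y hy hy2
        have h3 : (k : ℝ) * (1 - ‖y‖) ≤ 1 := by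
          rw [sub_lt_comm, lt_div_iff₀ hk'] at hy2
          linarith
        have h4 : 0 ≤ (k : ℝ) * (1 - ‖y‖) := mul_nonneg hk'.le (by linarith)
        simp [ballCutoff, h3, h4]
      have hz : z ≠ 0 := norm_ne_zero_iff.1 h0
      have hd : HasFDerivAt (fun y : E => ‖y‖) (innerSL ℝ (‖z‖⁻¹ • z)) z := by
        have h5 := ((hasStrictFDerivAt_norm_sq z).hasFDerivAt).sqrt (by positivity)
        have h6 : (fun y : E => √(‖y‖ ^ 2)) = fun y => ‖y‖ := by
          ext y; exact Real.sqrt_sq (norm_nonneg y)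
        rw [h6] at h5
        convert h5 using 1
        ext y
        simp only [innerSL_apply_apply, inner_smul_left, Real.sqrt_sq (norm_nonneg z)]
        simp
        field_simp
      have hd2 : HasFDerivAt (fun y : E => (k : ℝ) * (1 - ‖y‖))
          ((k : ℝ) • (- innerSL ℝ (‖z‖⁻¹ • z))) z := by
        simpa using (hd.const_sub 1).const_mul (k : ℝ)
      rw [hev.lineDeriv_eq, (hd2.hasLineDerivAt (-e)).lineDeriv]
      simp [inner_smul_left]
  · rw [indicator_of_notMem (by simp only [mem_Ioo, not_and]; intro h; linarith), zero_mul]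
    have hev : (ballCutoff k : E → ℝ) =ᶠ[𝓝 z] fun _ => 0 := by
      filter_upwards [continuousAt_const.eventually_lt continuous_norm.continuousAt h1] with y hy
      exact ballCutoff_eq_zero k hy.le
    rw [hev.lineDeriv_eq]
    simp [lineDeriv]

/-- The integral is the difference quotient of $-(1-t)^n/n$ at $0$ with step $1/k$, and the
derivative there is $1$. Hence the shell weights converge to surface measure with no extra constant.
-/
theorem tendsto_shell_integral {n : ℕ} (hn : 0 < n) :
    Tendsto (fun k : ℕ => ∫ r in Ioi (0 : ℝ), r ^ (n - 1) *
      (Ioo (1 - 1 / k : ℝ) 1).indicator (fun _ => (k : ℝ)) r) atTop (𝓝 1) := by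
  have hn' : (n : ℝ) ≠ 0 := by positivity
  have hval : ∀ k : ℕ, 0 < k → ∫ r in Ioi (0 : ℝ), r ^ (n - 1) *
      (Ioo (1 - 1 / k : ℝ) 1).indicator (fun _ => (k : ℝ)) r =
      ((1 / k : ℝ))⁻¹ * ((- (1 - (1 / k : ℝ)) ^ n / n) - (- (1 : ℝ) / n)) := by
    intro k hk
    have hk1 : (1 : ℝ) ≤ k := by exact_mod_cast hk
    have h0 : 0 ≤ 1 - 1 / (k : ℝ) := by
      rw [sub_nonneg, div_le_one (by positivity)]; exact hk1
    have h1 : 1 - 1 / (k : ℝ) ≤ 1 := by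
      have : 0 ≤ 1 / (k : ℝ) := by positivity
      linarith
    have e1 : ∀ r : ℝ, r ^ (n - 1) * (Ioo (1 - 1 / k : ℝ) 1).indicator (fun _ => (k : ℝ)) r =
        (Ioo (1 - 1 / k : ℝ) 1).indicator (fun r => r ^ (n - 1) * (k : ℝ)) r := fun r => by
      by_cases hr : r ∈ Ioo (1 - 1 / k : ℝ) 1
      · rw [indicator_of_mem hr, indicator_of_mem hr]
      · rw [indicator_of_notMem hr, indicator_of_notMem hr, mul_zero]
    have e2 : Ioi (0 : ℝ) ∩ Ioo (1 - 1 / k : ℝ) 1 = Ioo (1 - 1 / k : ℝ) 1 :=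
      inter_eq_right.2 fun r hr => h0.trans_lt hr.1
    simp_rw [e1]
    rw [setIntegral_indicator measurableSet_Ioo, e2,
      ← integral_Ioc_eq_integral_Ioo, ← intervalIntegral.integral_of_le h1,
      intervalIntegral.integral_mul_const, integral_pow]
    rw [Nat.sub_add_cancel hn]
    have hn1 : ((n - 1 : ℕ) : ℝ) + 1 = n := by exact_mod_cast Nat.sub_add_cancel hn
    rw [hn1]
    field_simp
    ring
  have hder : HasDerivAt (fun t : ℝ => - (1 - t) ^ n / n) 1 0 := by
    have := ((((hasDerivAt_id (0 : ℝ)).const_sub 1).pow n).neg).div_const (n : ℝ)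
    refine HasDerivAt.congr_deriv this ?_
    simp [hn']
  have hseq : Tendsto (fun m : ℕ => 1 / (m : ℝ)) atTop (𝓝[≠] 0) := by
    refine tendsto_nhdsWithin_iff.2 ⟨tendsto_const_div_atTop_nhds_zero_nat _, ?_⟩
    filter_upwards [eventually_gt_atTop 0] with m hm
    have : (0 : ℝ) < 1 / m := by positivity
    exact this.ne'
  refine (hder.tendsto_slope_zero.comp hseq).congr' ?_
  filter_upwards [eventually_gt_atTop 0] with k hk
  rw [hval k hk]
  simp

/-- The divergence theorem on the unit ball for a Lipschitz function and a constant direction. -/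
theorem integral_lineDeriv_ball {L : ℝ≥0} {h : E → ℝ} (hh : LipschitzWith L h) (e : E) :
    ∫ z in Metric.closedBall (0 : E) 1, lineDeriv ℝ h z e =
      ∫ ω, h (ω : E) * inner ℝ (ω : E) e ∂(volume : Measure E).toSphere := by
  set σ := (volume : Measure E).toSphere
  set B := ∫ ω, h (ω : E) * inner ℝ (ω : E) e ∂σ
  let φ : ℕ → ℝ → ℝ := fun k => (Ioo (1 - 1 / k : ℝ) 1).indicator (fun _ => (k : ℝ))
  let a : ℕ → ℝ := fun k => ∫ r in Ioi (0 : ℝ), r ^ (Module.finrank ℝ E - 1) * φ k r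
  have ha : Tendsto a atTop (𝓝 1) := tendsto_shell_integral Module.finrank_pos
  have hφ0 : ∀ k r, 0 ≤ φ k r := fun k r => indicator_nonneg (fun _ _ => by positivity) _
  have hφm : ∀ k, Measurable (φ k) := fun k => measurable_const.indicator measurableSet_Ioo
  have hae : ∀ᵐ z : E, ‖z‖ ≠ 1 := by
    have := Measure.addHaar_sphere (volume : Measure E) 0 1
    filter_upwards [measure_eq_zero_iff_ae_notMem.1 this] with z hz
    simpa using hz
  -- The cut-offs tend to the indicator of the ball off the unit sphere, which is null.
  have hlim1 : Tendsto (fun k : ℕ => ∫ z, lineDeriv ℝ h z e * ballCutoff k z) atTop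
      (𝓝 (∫ z in Metric.closedBall (0 : E) 1, lineDeriv ℝ h z e)) := by
    rw [← integral_indicator Metric.isClosed_closedBall.measurableSet]
    refine tendsto_integral_of_dominated_convergence
      ((Metric.closedBall (0 : E) 1).indicator fun _ => L * ‖e‖) (fun k => ?_) ?_ (fun k => ?_) ?_
    · exact (aestronglyMeasurable_lineDeriv hh.continuous _).mul
        (lipschitzWith_ballCutoff k).continuous.aestronglyMeasurable
    · exact (integrable_indicator_iff Metric.isClosed_closedBall.measurableSet).2
        (integrableOn_const (isCompact_closedBall _ _).measure_ne_top)
    · refine Eventually.of_forall fun z => ?_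
      by_cases hz : z ∈ Metric.closedBall (0 : E) 1
      · rw [indicator_of_mem hz, norm_mul]
        have h1 := norm_lineDeriv_le_of_lipschitz ℝ hh (x₀ := z) (v := e)
        have h2 : ‖ballCutoff k z‖ ≤ 1 := by
          rw [Real.norm_eq_abs, abs_of_nonneg (le_max_left _ _)]
          exact max_le zero_le_one (min_le_left _ _)
        calc _ ≤ (L * ‖e‖) * 1 := by gcongr
          _ = _ := mul_one _
      · rw [indicator_of_notMem hz, ballCutoff_eq_zero k (by simp at hz; exact hz.le)]
        simp
    · filter_upwards [hae] with z hz
      rcases lt_or_gt_of_ne hz with hz | hz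
      · rw [indicator_of_mem (by simpa using hz.le)]
        refine tendsto_const_nhds.congr' ?_
        have : Tendsto (fun k : ℕ => (k : ℝ) * (1 - ‖z‖)) atTop atTop :=
          tendsto_natCast_atTop_atTop.atTop_mul_const (by linarith)
        filter_upwards [this.eventually_ge_atTop 1] with k hk
        simp [ballCutoff, hk]
      · rw [indicator_of_notMem (by simpa using hz)]
        simp [ballCutoff_eq_zero _ hz.le]
  have hint : ∀ k, Integrable (fun z : E => φ k ‖z‖) := fun k => by
    refine Integrable.mono' (g := (Metric.closedBall (0 : E) 1).indicator fun _ => (k : ℝ))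
      ((integrable_indicator_iff Metric.isClosed_closedBall.measurableSet).2
        (integrableOn_const (isCompact_closedBall _ _).measure_ne_top))
      ((hφm k).comp measurable_norm).aestronglyMeasurable (Eventually.of_forall fun z => ?_)
    by_cases hz : ‖z‖ ∈ Ioo (1 - 1 / k : ℝ) 1
    · rw [indicator_of_mem (by simpa using hz.2.le)]
      simp only [φ, indicator_of_mem hz, Real.norm_natCast, le_refl]
    · simp only [φ, indicator_of_notMem hz, norm_zero]
      exact indicator_nonneg (fun _ _ => by positivity) _
  have hdir : ∀ z : E, ‖‖z‖⁻¹ • z‖ ≤ 1 := fun z => by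
    rw [norm_smul, norm_inv, norm_norm]
    exact inv_mul_le_one
  -- Integration by parts puts the derivative on the cut-off, supported in the shell. There $h(z)$
  -- differs from $h(z/\|z\|)$ by at most $L/k$, and after this replacement polar coordinates give
  -- exactly `B * a k`.
  have hbound : ∀ k : ℕ, 0 < k → |(∫ z, lineDeriv ℝ h z e * ballCutoff k z) - B * a k| ≤
      (‖e‖ * L * σ.real univ) * (a k * (1 / k)) := by
    intro k hk
    have hk1 : (1 : ℝ) ≤ k := by exact_mod_cast hk
    have hmeas : Measurable fun z : E => ‖z‖⁻¹ • z := by fun_prop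
    have hY : Integrable (fun z : E => φ k ‖z‖ * (h (‖z‖⁻¹ • z) * inner ℝ (‖z‖⁻¹ • z) e)) := by
      refine Integrable.mono' ((hint k).mul_const ((|h 0| + L) * ‖e‖)) ?_
        (Eventually.of_forall fun z => ?_)
      · exact (((hφm k).comp measurable_norm).mul ((hh.continuous.measurable.comp hmeas).mul
          (hmeas.inner_const))).aestronglyMeasurable
      · rw [norm_mul, norm_mul, Real.norm_of_nonneg (hφ0 k _)]
        have h1 := hh.dist_le_mul (‖z‖⁻¹ • z) 0
        rw [dist_zero_right, Real.dist_eq] at h1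
        have h2 : |h (‖z‖⁻¹ • z)| ≤ |h 0| + L := by
          have h3 := abs_sub_abs_le_abs_sub (h (‖z‖⁻¹ • z)) (h 0)
          have h4 : (L : ℝ) * ‖‖z‖⁻¹ • z‖ ≤ L * 1 := by gcongr; exact hdir z
          linarith
        have h5 : ‖inner ℝ (‖z‖⁻¹ • z) e‖ ≤ ‖e‖ := (norm_inner_le_norm _ _).trans
          ((mul_le_mul_of_nonneg_right (hdir z) (norm_nonneg _)).trans_eq (one_mul _))
        have := hφ0 k ‖z‖
        gcongr
        exact h2
    have hZb : ∀ z : E, ‖φ k ‖z‖ * (inner ℝ (‖z‖⁻¹ • z) e * (h z - h (‖z‖⁻¹ • z)))‖ ≤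
        φ k ‖z‖ * (‖e‖ * L * (1 / k)) := by
      intro z
      by_cases hz : ‖z‖ ∈ Ioo (1 - 1 / k : ℝ) 1
      · rw [norm_mul, norm_mul, Real.norm_of_nonneg (hφ0 k _), mul_assoc ‖e‖]
        have hz0 : ‖z‖ ≠ 0 := by
          have : 1 / (k : ℝ) ≤ 1 := by rw [div_le_one (by positivity)]; exact hk1
          have := hz.1
          intro h0
          linarith
        have h5 : ‖inner ℝ (‖z‖⁻¹ • z) e‖ ≤ ‖e‖ := (norm_inner_le_norm _ _).trans
          ((mul_le_mul_of_nonneg_right (hdir z) (norm_nonneg _)).trans_eq (one_mul _))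
        have h6 : ‖z - ‖z‖⁻¹ • z‖ ≤ 1 / k := by
          have : z - ‖z‖⁻¹ • z = (1 - ‖z‖⁻¹) • z := by module
          rw [this, norm_smul, Real.norm_eq_abs]
          have h7 : |1 - ‖z‖⁻¹| * ‖z‖ = |‖z‖ - 1| := by
            rw [← abs_norm z, ← abs_mul, abs_norm, sub_mul, inv_mul_cancel₀ hz0, one_mul]
          rw [h7, abs_sub_comm, abs_of_pos (by linarith [hz.2])]
          linarith [hz.1]
        have h7 := hh.dist_le_mul z (‖z‖⁻¹ • z)
        rw [dist_eq_norm, dist_eq_norm] at h7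
        have h8 : ‖h z - h (‖z‖⁻¹ • z)‖ ≤ L * (1 / k) :=
          h7.trans (mul_le_mul_of_nonneg_left h6 L.2)
        have := hφ0 k ‖z‖
        gcongr
      · simp only [φ, indicator_of_notMem hz, zero_mul, norm_zero, le_refl]
    have hZ : Integrable (fun z : E =>
        φ k ‖z‖ * (inner ℝ (‖z‖⁻¹ • z) e * (h z - h (‖z‖⁻¹ • z)))) := by
      refine Integrable.mono' ((hint k).mul_const _) ?_ (Eventually.of_forall hZb)
      exact (((hφm k).comp measurable_norm).mul ((hmeas.inner_const).mul
        (hh.continuous.measurable.sub (hh.continuous.measurable.comp hmeas)))).aestronglyMeasurable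
    rw [LipschitzWith.integral_lineDeriv_mul_eq hh (lipschitzWith_ballCutoff k)
      (hasCompactSupport_ballCutoff k)]
    have hsplit : ∫ z, lineDeriv ℝ (ballCutoff k) z (-e) * h z =
        (∫ z, φ k ‖z‖ * (h (‖z‖⁻¹ • z) * inner ℝ (‖z‖⁻¹ • z) e)) +
        ∫ z, φ k ‖z‖ * (inner ℝ (‖z‖⁻¹ • z) e * (h z - h (‖z‖⁻¹ • z))) := by
      rw [← integral_add hY hZ]
      refine integral_congr_ae ?_
      filter_upwards [ae_lineDeriv_ballCutoff k hk e] with z hz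
      rw [hz]
      simp only [φ]
      ring
    have hmain := integral_radial_mul_direction (volume : Measure E) (φ k)
      (fun x => h x * inner ℝ x e)
    have hone := integral_radial_mul_direction (volume : Measure E) (φ k) (fun _ => 1)
    simp only [mul_one, integral_const, smul_eq_mul] at hone
    rw [hsplit, hmain, add_sub_cancel_left]
    refine (norm_integral_le_of_norm_le ((hint k).mul_const _) (Eventually.of_forall hZb)).trans ?_
    rw [integral_mul_const, hone]
    refine le_of_eq ?_
    simp only [a, σ]
    ring
  have hlim2 : Tendsto (fun k : ℕ => ∫ z, lineDeriv ℝ h z e * ballCutoff k z) atTop (𝓝 B) := by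
    have h1 : Tendsto (fun k : ℕ => (‖e‖ * L * σ.real univ) * (a k * (1 / k))) atTop (𝓝 0) := by
      simpa using (ha.mul (tendsto_const_div_atTop_nhds_zero_nat 1)).const_mul
        (‖e‖ * L * σ.real univ)
    have h2 : Tendsto (fun k : ℕ => (∫ z, lineDeriv ℝ h z e * ballCutoff k z) - B * a k) atTop
        (𝓝 0) := squeeze_zero_norm' ((eventually_gt_atTop 0).mono hbound) h1
    simpa using h2.add (ha.const_mul B)
  exact tendsto_nhds_unique hlim1 hlim2

end Divergence

/-! ### The gradient of the randomized smoothing as a sphere average. -/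

section SmoothingGradient

variable {d : ℕ}

/-- The gradient of the randomized smoothing of a Lipschitz function. -/
theorem hasGradientAt_smoothing_of_lipschitz (hd : 0 < d) {η : ℝ} (hη : 0 < η) {L : ℝ≥0}
    {h : Strat d → ℝ} (hh : LipschitzWith L h) (x : Strat d) :
    HasGradientAt (smoothing η h)
      (∫ v, ((d : ℝ) / η * h (x + v)) • (‖v‖⁻¹ • v) ∂(sphereUniform d η)) x := by
  have : Nonempty (Fin d) := ⟨⟨0, hd⟩⟩
  set B := Metric.closedBall (0 : Strat d) 1
  have hB0 : (volume : Measure (Strat d)) B ≠ 0 :=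
    (Metric.measure_closedBall_pos volume _ one_pos).ne'
  have hBt : (volume : Measure (Strat d)) B ≠ ∞ := (isCompact_closedBall _ _).measure_ne_top
  have hBr : 0 < (volume : Measure (Strat d)).real B := ENNReal.toReal_pos hB0 hBt
  have hk : LipschitzWith (L * η.toNNReal) (fun u => h (x + η • u)) := by
    refine LipschitzWith.of_dist_le_mul fun u w => ?_
    have := hh.dist_le_mul (x + η • u) (x + η • w)
    rw [dist_add_left, dist_smul₀, Real.norm_of_nonneg hη.le] at this
    push_cast [Real.coe_toNNReal η hη.le]
    linarith
  -- Rademacher's theorem is applied to $u\mapsto h(x+\eta u)$ and the affine substitution undone,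
  -- so no null set in the variable $x+\eta u$ has to be transported.
  have hdiff : ∀ᵐ u : Strat d, DifferentiableAt ℝ h (x + η • u) := by
    filter_upwards [hk.ae_differentiableAt] with u hu
    have hcomp : h = (fun u => h (x + η • u)) ∘ fun z => η⁻¹ • (z - x) := by
      ext z
      simp [smul_smul, hη.ne']
    rw [hcomp]
    refine DifferentiableAt.comp _ ?_ (by fun_prop)
    simpa [smul_smul, hη.ne'] using hu
  have hcompint : ∀ y, IntegrableOn (fun u => h (y + η • u)) B := fun y =>
    (hh.continuous.comp (by fun_prop)).continuousOn.integrableOn_compact (isCompact_closedBall _ _)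
  have hder := hasFDerivAt_integral_of_dominated_loc_of_lip (μ := volume.restrict B)
    (F := fun y u => h (y + η • u)) (F' := fun u => fderiv ℝ h (x + η • u)) (x₀ := x)
    (bound := fun _ => (L : ℝ)) (s := univ) univ_mem
    (Eventually.of_forall fun y => (hcompint y).aestronglyMeasurable) (hcompint x)
    ((measurable_fderiv ℝ h).comp (by fun_prop)).aestronglyMeasurable
    (Eventually.of_forall fun u => by
      have : LipschitzWith L (fun y => h (y + η • u)) := LipschitzWith.of_dist_le_mul fun y z => by
        simpa using hh.dist_le_mul (y + η • u) (z + η • u)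
      simpa using this)
    (integrableOn_const hBt)
    (ae_restrict_of_ae (hdiff.mono fun u hu => by
      have := HasFDerivAt.comp x (f := fun y => y + η • u) hu.hasFDerivAt
        ((hasFDerivAt_id x).add_const (η • u))
      simpa [Function.comp_def] using this))
  have hsm : smoothing η h = fun y => (volume.real B)⁻¹ • ∫ u in B, h (y + η • u) := by
    ext y
    rw [smoothing, setAverage_eq]
  rw [hsm, hasGradientAt_iff_hasFDerivAt]
  refine (hder.2.const_smul (volume.real B)⁻¹).congr_fderiv ?_
  ext1 e
  have hle : ∀ᵐ u ∂(volume.restrict B), fderiv ℝ h (x + η • u) e =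
      η⁻¹ * lineDeriv ℝ (fun u => h (x + η • u)) u e := by
    refine ae_restrict_of_ae (hdiff.mono fun u hu => ?_)
    have h1 : HasFDerivAt (fun u : Strat d => x + η • u) (η • ContinuousLinearMap.id ℝ _) u :=
      ((hasFDerivAt_id u).const_smul η).const_add x
    have h2 := (hu.hasFDerivAt.comp u h1).hasLineDerivAt e
    have h3 : lineDeriv ℝ (fun u => h (x + η • u)) u e = η * fderiv ℝ h (x + η • u) e := by
      rw [← Function.comp_def h, h2.lineDeriv]
      simp
    rw [h3, inv_mul_cancel_left₀ hη.ne']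
  have hsphint : Integrable (fun ω : Metric.sphere (0 : Strat d) 1 =>
      ((d : ℝ) / η * h (x + η • (ω : Strat d))) •
        (‖η • (ω : Strat d)‖⁻¹ • (η • (ω : Strat d)))) (volume : Measure (Strat d)).toSphere := by
    have : Continuous (fun ω : Metric.sphere (0 : Strat d) 1 =>
      ((d : ℝ) / η * h (x + η • (ω : Strat d))) •
        (‖η • (ω : Strat d)‖⁻¹ • (η • (ω : Strat d)))) := by
      have h0 := hh.continuous
      have h1 : ∀ ω : Metric.sphere (0 : Strat d) 1, ‖η • (ω : Strat d)‖ = η := fun ω => by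
        simp [norm_smul, abs_of_pos hη]
      simp_rw [h1]
      fun_prop
    exact this.integrable_of_hasCompactSupport (HasCompactSupport.of_compactSpace _)
  have hnorm : ∀ ω : Metric.sphere (0 : Strat d) 1, ‖η • (ω : Strat d)‖ = η := fun ω => by
    simp [norm_smul, abs_of_pos hη]
  -- The ball average divides by the volume, the sphere average by the surface mass. Their ratio is
  -- the factor `d` of $d/\eta$; the $1/\eta$ comes from the chain rule in `hle`.
  have hσ : (volume : Measure (Strat d)).toSphere.real univ = d * volume.real B := by
    rw [Measure.toSphere_real_apply_univ, finrank_euclideanSpace, Fintype.card_fin]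
    congr 1
    simp only [measureReal_def, B, Measure.addHaar_closedBall_eq_addHaar_ball]
  have hinner := integral_inner (𝕜 := ℝ) hsphint e
  rw [InnerProductSpace.toDual_apply_apply, FunLike.coe_smul, Pi.smul_apply,
    ContinuousLinearMap.integral_apply hder.1, integral_congr_ae hle, integral_const_mul,
    integral_lineDeriv_ball hk e, integral_sphereUniform hη, inner_smul_left, real_inner_comm,
    ← hinner, hσ, smul_eq_mul]
  simp only [hnorm, smul_smul, inner_smul_right, inv_mul_cancel₀ hη.ne', mul_one]
  simp_rw [mul_assoc, real_inner_comm]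
  rw [integral_const_mul]
  have hd' : (d : ℝ) ≠ 0 := by positivity
  simp
  field_simp

/-- Local version of `hasGradientAt_smoothing_of_lipschitz`. -/
theorem hasGradientAt_smoothing (hd : 0 < d) {η : ℝ} (hη : 0 < η) {L : ℝ≥0} {U : Set (Strat d)}
    (hU : IsOpen U) {h : Strat d → ℝ} (hh : LipschitzOnWith L h U) {x : Strat d}
    (hx : Metric.closedBall x η ⊆ U) :
    HasGradientAt (smoothing η h)
      (∫ v, ((d : ℝ) / η * h (x + v)) • (‖v‖⁻¹ • v) ∂(sphereUniform d η)) x := by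
  obtain ⟨g, hg, hgU⟩ := hh.extend_real
  -- By compactness a whole neighbourhood of the closed ball lies in `U`, so for `y` near `x` the
  -- smoothing sees only points where the extension agrees with `h`.
  obtain ⟨δ, hδ, hδU⟩ := (isCompact_closedBall x η).exists_thickening_subset_open hU hx
  have hev : smoothing η h =ᶠ[𝓝 x] smoothing η g := by
    filter_upwards [Metric.ball_mem_nhds x hδ] with y hy
    rw [smoothing, smoothing]
    refine setAverage_congr_fun Metric.isClosed_closedBall.measurableSet
      (Eventually.of_forall fun u hu => hgU (hδU ?_))
    rw [Metric.mem_thickening_iff]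
    refine ⟨x + η • u, ?_, by simpa using hy⟩
    rw [mem_closedBall_zero_iff] at hu
    simpa [norm_smul, abs_of_pos hη] using mul_le_of_le_one_right hη.le hu
  have hint : ∫ v, ((d : ℝ) / η * h (x + v)) • (‖v‖⁻¹ • v) ∂(sphereUniform d η) =
      ∫ v, ((d : ℝ) / η * g (x + v)) • (‖v‖⁻¹ • v) ∂(sphereUniform d η) := by
    refine integral_congr_ae ?_
    filter_upwards [ae_norm_eq_sphereUniform hη] with v hv
    rw [hgU (hx (by simp [hv]))]
  rw [hint]
  exact (hasGradientAt_smoothing_of_lipschitz hd hη hg x).congr_of_eventuallyEq hev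

end SmoothingGradient

/-! ### Antipodal symmetry of the sphere. -/

section NegInvariance

/-- The surface measure of a set is defined through the volume of the cone over it, and Haar measure
is invariant under negation. -/
theorem measurePreserving_neg_toSphere {E : Type*} [NormedAddCommGroup E] [NormedSpace ℝ E]
    [FiniteDimensional ℝ E] [MeasurableSpace E] [BorelSpace E] (μ : Measure E)
    [μ.IsAddHaarMeasure] :
    MeasurePreserving (fun ω : Metric.sphere (0 : E) 1 => -ω) μ.toSphere μ.toSphere := by
  have hm : Measurable (fun ω : Metric.sphere (0 : E) 1 => -ω) := continuous_neg.measurable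
  refine ⟨hm, ?_⟩
  ext s hs
  rw [Measure.map_apply hm hs, μ.toSphere_apply' hs, μ.toSphere_apply' (hm hs)]
  congr 1
  rw [← Measure.measure_neg μ (Ioo (0 : ℝ) 1 • (Subtype.val '' s))]
  congr 1
  ext z
  simp only [Set.mem_smul, Set.mem_neg, mem_image, mem_preimage]
  constructor
  · rintro ⟨t, ht, _, ⟨ω, hω, rfl⟩, rfl⟩
    exact ⟨t, ht, _, ⟨_, hω, rfl⟩, by simp⟩
  · rintro ⟨t, ht, _, ⟨ω, hω, rfl⟩, hz⟩
    refine ⟨t, ht, _, ⟨-ω, by simpa using hω, rfl⟩, ?_⟩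
    rw [← neg_neg z, ← hz]
    simp

theorem integral_neg_sphereUniform {d : ℕ} {F : Type*} [NormedAddCommGroup F] [NormedSpace ℝ F]
    {η : ℝ} (hη : 0 < η) (f : Strat d → F) :
    ∫ v, f (-v) ∂(sphereUniform d η) = ∫ v, f v ∂(sphereUniform d η) := by
  rw [integral_sphereUniform hη, integral_sphereUniform hη]
  congr 1
  have := (measurePreserving_neg_toSphere (volume : Measure (Strat d))).integral_comp
    (Homeomorph.neg (Metric.sphere (0 : Strat d) 1)).measurableEmbedding (fun ω => f (η • (ω : Strat d)))
  rw [← this]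
  simp

end NegInvariance

theorem integral_norm_sub_integral_sq_le {Ω E : Type*} [MeasurableSpace Ω] {P : Measure Ω}
    [IsProbabilityMeasure P] [NormedAddCommGroup E] [InnerProductSpace ℝ E] [CompleteSpace E]
    {Z : Ω → E} (hZ : MemLp Z 2 P) :
    ∫ ω, ‖Z ω - ∫ ω', Z ω' ∂P‖ ^ 2 ∂P ≤ ∫ ω, ‖Z ω‖ ^ 2 ∂P := by
  set z := ∫ ω', Z ω' ∂P
  have e : ∀ ω, ‖Z ω - z‖ ^ 2 = (‖Z ω‖ ^ 2 - 2 * inner ℝ z (Z ω)) + ‖z‖ ^ 2 := fun ω => by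
    rw [norm_sub_sq_real, real_inner_comm]
  have hZ1 := hZ.integrable (by norm_num)
  have hsq := hZ.norm.integrable_sq
  have hi := (hZ1.const_inner (𝕜 := ℝ) z).const_mul 2
  have hs : Integrable (fun ω => ‖Z ω‖ ^ 2 - 2 * inner ℝ z (Z ω)) P := hsq.sub hi
  simp_rw [e]
  rw [integral_add hs (integrable_const _), integral_sub hsq hi, integral_const_mul,
    integral_inner hZ1, real_inner_self_eq_norm_sq]
  simp only [integral_const, probReal_univ, smul_eq_mul, one_mul]
  nlinarith [sq_nonneg ‖z‖]

/-! ### Unilateral deviations. -/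

section Profile
variable {N : ℕ} {n : Fin N → ℕ}

@[simp] theorem deviate_apply_self (x : Profile n) (i : Fin N) (y : Strat (n i)) :
    deviate x i y i = y := by
  simp [deviate]

@[simp] theorem deviate_self (x : Profile n) (i : Fin N) : deviate x i (x i) = x := by
  ext j : 1
  simp [deviate]

theorem deviate_of_ne (x : Profile n) {i j : Fin N} (hj : j ≠ i) (y : Strat (n i)) :
    deviate x i y j = x j := by
  simp [deviate, hj]

@[simp] theorem deviate_deviate (x : Profile n) (i : Fin N) (y z : Strat (n i)) :
    deviate (deviate x i y) i z = deviate x i z := by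
  ext j : 1
  simp [deviate]

theorem continuous_deviate (i : Fin N) :
    Continuous (fun p : Profile n × Strat (n i) => deviate p.1 i p.2) := by
  unfold deviate
  refine (PiLp.continuous_toLp 2 _).comp ?_
  refine Continuous.update ?_ i continuous_snd
  exact (PiLp.continuous_ofLp 2 _).comp continuous_fst

end Profile

/-! ### The one-sample estimator: measurability, mean and variance. -/

namespace StochGame
variable {N : ℕ} {n : Fin N → ℕ} {Ξ : Type*}

theorem deviate_mem_feasible {G : StochGame n Ξ} {x : Profile n} (hx : x ∈ G.feasible) {i : Fin N}
    {y : Strat (n i)} (hy : y ∈ G.X i) : deviate x i y ∈ G.feasible := by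
  intro j
  rcases eq_or_ne j i with rfl | hj
  · simpa using hy
  · rw [deviate_of_ne x hj]
    exact hx j

/-- The stochastic direction of player `i` built from a single sample pair. -/
noncomputable def estimator (G : StochGame n Ξ) (η : ℝ) (i : Fin N) (x : Profile n)
    (p : Ξ × Strat (n i)) : Strat (n i) :=
  G.zerothOrder η i x p.1 p.2 + G.gradMt i x p.1

theorem batchDirection_eq (G : StochGame n Ξ) (η : ℝ) {S : ℕ} (i : Fin N) (x : Profile n)
    (w : Fin S → Ξ × Strat (n i)) :
    G.batchDirection η i x w = (S : ℝ)⁻¹ • ∑ l, G.estimator η i x (w l) := by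
  simp only [batchDirection, estimator, Finset.sum_add_distrib, smul_add]

variable [MeasurableSpace Ξ] {G : StochGame n Ξ} {μ : Measure Ξ} {η : ℝ} {Lip : Fin N → ℝ≥0}

theorem IsLipschitzGame.isClosed_feasible (hG : G.IsLipschitzGame μ η Lip) :
    IsClosed G.feasible := by
  have : G.feasible = ⋂ i, (fun x : Profile n => x i) ⁻¹' G.X i := by
    ext x; simp [feasible]
  rw [this]
  exact isClosed_iInter fun i => (hG.closed i).preimage (by fun_prop)

theorem IsLipschitzGame.convex_feasible (hG : G.IsLipschitzGame μ η Lip) :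
    Convex ℝ G.feasible := by
  intro x hx y hy a b ha hb hab i
  exact hG.convex i (hx i) (hy i) ha hb hab

theorem IsLipschitzGame.hasGradientAt_mt (hG : G.IsLipschitzGame μ η Lip) {x : Profile n}
    (hx : x ∈ G.feasible) (i : Fin N) (s : Ξ) :
    HasGradientAt (fun y => G.mt i (deviate x i y) s) (G.gradMt i x s) (x i) := by
  obtain ⟨O, hO, hXO, hsm⟩ := hG.smooth i
  have := ((hsm x hx).1 s).differentiableOn (by simp) |>.differentiableAt
    (hO.mem_nhds (hXO (hx i)))
  exact this.hasGradientAt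

/-- Differentiability is known only at feasible profiles, hence the indicator. There the coordinates
of the gradient are limits of difference quotients with step $1/k$, which are jointly measurable. -/
theorem IsLipschitzGame.measurable_gradMt (hG : G.IsLipschitzGame μ η Lip) (i : Fin N) :
    Measurable (fun q : Profile n × Ξ =>
      (Prod.fst ⁻¹' G.feasible).indicator (fun q : Profile n × Ξ => G.gradMt i q.1 q.2) q) := by
  have hfm : MeasurableSet (Prod.fst ⁻¹' G.feasible : Set (Profile n × Ξ)) :=
    measurable_fst hG.isClosed_feasible.measurableSet
  let A : ℕ → Profile n × Ξ → Strat (n i) := fun k q => WithLp.toLp 2 fun j =>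
    (k : ℝ) * (G.mt i (deviate q.1 i (q.1 i + (k : ℝ)⁻¹ • EuclideanSpace.single j 1)) q.2
      - G.mt i q.1 q.2)
  have hA : ∀ k, Measurable (A k) := fun k => by
    refine (WithLp.measurable_toLp 2 _).comp (measurable_pi_lambda _ fun j => ?_)
    refine ((Measurable.sub ?_ (hG.measurable_mt i)).const_mul _)
    refine (hG.measurable_mt i).comp (Measurable.prodMk ?_ measurable_snd)
    have : Continuous (fun x : Profile n =>
        (x, x i + (k : ℝ)⁻¹ • (EuclideanSpace.single j 1 : Strat (n i)))) := by fun_prop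
    exact ((continuous_deviate i).comp this).measurable.comp measurable_fst
  refine measurable_of_tendsto_metrizable (fun k => (hA k).indicator hfm) ?_
  rw [tendsto_pi_nhds]
  intro q
  by_cases hq : q ∈ (Prod.fst ⁻¹' G.feasible : Set (Profile n × Ξ))
  · simp only [indicator_of_mem hq]
    have hgrad := (hG.hasGradientAt_mt hq i q.2).hasFDerivAt
    have : Tendsto (fun k => WithLp.ofLp (A k q)) atTop (𝓝 (WithLp.ofLp (G.gradMt i q.1 q.2))) := by
      rw [tendsto_pi_nhds]
      intro j
      have hl := (hgrad.hasLineDerivAt (EuclideanSpace.single j 1)).tendsto_slope_zero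
      have hseq : Tendsto (fun m : ℕ => (m : ℝ)⁻¹) atTop (𝓝[≠] 0) := by
        refine tendsto_nhdsWithin_iff.2 ⟨tendsto_inv_atTop_nhds_zero_nat, ?_⟩
        filter_upwards [eventually_gt_atTop 0] with m hm
        have : (0 : ℝ) < (m : ℝ)⁻¹ := by positivity
        exact this.ne'
      have := hl.comp hseq
      simpa [A, Function.comp_def, EuclideanSpace.inner_single_right] using this
    exact (PiLp.continuous_toLp 2 _).continuousAt.tendsto.comp this
  · simp only [indicator_of_notMem hq]
    exact tendsto_const_nhds

theorem IsLipschitzGame.measurable_zerothOrder (hG : G.IsLipschitzGame μ η Lip) (i : Fin N) :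
    Measurable (fun q : Profile n × Ξ × Strat (n i) => G.zerothOrder η i q.1 q.2.1 q.2.2) := by
  unfold zerothOrder
  have hx : Measurable (fun q : Profile n × Ξ × Strat (n i) => q.1 i) := by
    have : Continuous (fun x : Profile n => x i) := by fun_prop
    exact this.measurable.comp measurable_fst
  have hv : Measurable (fun q : Profile n × Ξ × Strat (n i) => q.2.2) := by fun_prop
  have h1 := (hG.measurable_ht i).comp ((hx.add hv).prodMk (measurable_snd.fst))
  have h2 := (hG.measurable_ht i).comp ((hx.sub hv).prodMk (measurable_snd.fst))
  exact ((h1.sub h2).const_mul _).smul (hv.norm.inv.smul hv)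

/-- The estimator, set to zero at infeasible profiles, is jointly measurable. -/
theorem IsLipschitzGame.measurable_estimator (hG : G.IsLipschitzGame μ η Lip) (i : Fin N) :
    Measurable (fun q : Profile n × Ξ × Strat (n i) =>
      (Prod.fst ⁻¹' G.feasible).indicator
        (fun q : Profile n × Ξ × Strat (n i) => G.estimator η i q.1 q.2) q) := by
  have hfm : MeasurableSet (Prod.fst ⁻¹' G.feasible : Set (Profile n × Ξ × Strat (n i))) :=
    measurable_fst hG.isClosed_feasible.measurableSet
  have h1 := (hG.measurable_zerothOrder i).indicator hfm
  have h2 := (hG.measurable_gradMt i).comp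
    (measurable_fst.prodMk measurable_snd.fst :
      Measurable fun q : Profile n × Ξ × Strat (n i) => (q.1, q.2.1))
  convert h1.add h2 using 1
  ext1 q
  by_cases hq : q.1 ∈ G.feasible
  · simp [indicator, hq, estimator]
  · simp [indicator, hq]

/-- At a feasible profile, all evaluations of the estimator stay in the domain on which the private
term is Lipschitz; the private term is extended to a globally Lipschitz function. -/
theorem IsLipschitzGame.exists_extension (hG : G.IsLipschitzGame μ η Lip) {x : Profile n}
    (hx : x ∈ G.feasible) (i : Fin N) (s : Ξ) :
    ∃ g : Strat (n i) → ℝ, LipschitzWith (Lip i) g ∧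
      ∀ v, ‖v‖ = η → G.ht i (x i + v) s = g (x i + v) ∧ G.ht i (x i - v) s = g (x i - v) := by
  obtain ⟨U, hU, hXU, hLip, -⟩ := hG.lipschitz i
  obtain ⟨g, hg, hgU⟩ := (hLip s).extend_real
  refine ⟨g, hg, fun v hv => ⟨hgU (hXU ?_), hgU (hXU ?_)⟩⟩
  · exact add_mem_add (hx i) (by simp [hv])
  · rw [sub_eq_add_neg]
    exact add_mem_add (hx i) (by simp [hv])

omit [MeasurableSpace Ξ] in
theorem norm_zerothOrder_sq (hη : 0 < η)
    {x : Profile n} (i : Fin N) (s : Ξ) {v : Strat (n i)} (hv : ‖v‖ = η) :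
    ‖G.zerothOrder η i x s v‖ ^ 2 =
      ((n i : ℝ) / (2 * η)) ^ 2 * (G.ht i (x i + v) s - G.ht i (x i - v) s) ^ 2 := by
  rw [zerothOrder, norm_smul, norm_smul, norm_inv, norm_norm, hv, inv_mul_cancel₀ hη.ne', mul_one,
    Real.norm_eq_abs, sq_abs, mul_pow]

theorem IsLipschitzGame.norm_zerothOrder_le (hG : G.IsLipschitzGame μ η Lip) (hη : 0 < η)
    {x : Profile n} (hx : x ∈ G.feasible) (i : Fin N) (s : Ξ) {v : Strat (n i)} (hv : ‖v‖ = η) :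
    ‖G.zerothOrder η i x s v‖ ≤ n i * Lip i := by
  obtain ⟨g, hg, hgv⟩ := hG.exists_extension hx i s
  rw [zerothOrder, norm_smul, norm_smul, norm_inv, norm_norm, hv, inv_mul_cancel₀ hη.ne', mul_one,
    norm_mul, (hgv v hv).1, (hgv v hv).2, Real.norm_of_nonneg (by positivity)]
  have h1 := hg.dist_le_mul (x i + v) (x i - v)
  have h2 : dist (x i + v) (x i - v) = 2 * η := by
    rw [dist_eq_norm, add_sub_sub_cancel, ← two_smul ℝ v, norm_smul, hv]
    simp
  rw [h2, dist_eq_norm] at h1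
  calc (n i : ℝ) / (2 * η) * ‖g (x i + v) - g (x i - v)‖ ≤ n i / (2 * η) * (Lip i * (2 * η)) := by
        gcongr
    _ = _ := by field_simp

theorem IsLipschitzGame.ae_norm_zerothOrder_le (hG : G.IsLipschitzGame μ η Lip) (hη : 0 < η)
    {x : Profile n} (hx : x ∈ G.feasible) (i : Fin N) :
    ∀ᵐ p ∂(μ.prod (sphereUniform (n i) η)), ‖G.zerothOrder η i x p.1 p.2‖ ≤ n i * Lip i := by
  filter_upwards [Measure.quasiMeasurePreserving_snd.ae (ae_norm_eq_sphereUniform hη)] with p hp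
  exact hG.norm_zerothOrder_le hη hx i p.1 hp

variable [IsProbabilityMeasure μ]

theorem IsLipschitzGame.memLp_zerothOrder (hG : G.IsLipschitzGame μ η Lip) (hη : 0 < η)
    (hn : ∀ i, 0 < n i) {x : Profile n} (hx : x ∈ G.feasible) (i : Fin N) :
    MemLp (fun p : Ξ × Strat (n i) => G.zerothOrder η i x p.1 p.2) 2
      (μ.prod (sphereUniform (n i) η)) := by
  have := isProbabilityMeasure_sphereUniform (hn i) η
  exact MemLp.of_bound ((hG.measurable_zerothOrder i).comp measurable_prodMk_left).aestronglyMeasurable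
    _ (hG.ae_norm_zerothOrder_le hη hx i)

/-- The pointwise bound $n_iL_i$ would give a second moment of order $n_i^2$. For each fixed sample,
the Poincaré inequality on the sphere saves one factor $n_i$. -/
theorem IsLipschitzGame.integral_zerothOrder_sq_le (hG : G.IsLipschitzGame μ η Lip) (hη : 0 < η)
    (hn : ∀ i, 0 < n i) {x : Profile n} (hx : x ∈ G.feasible) (i : Fin N) :
    ∫ p, ‖G.zerothOrder η i x p.1 p.2‖ ^ 2 ∂(μ.prod (sphereUniform (n i) η)) ≤
      16 * √(2 * Real.pi) * (Lip i : ℝ) ^ 2 * n i := by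
  have := isProbabilityMeasure_sphereUniform (hn i) η
  have hint := (hG.memLp_zerothOrder hη hn hx i).norm.integrable_sq
  have hn' : (0 : ℝ) < n i := by exact_mod_cast hn i
  rw [integral_prod _ hint]
  -- The sphere inequality yields $\frac94\pi^2\approx 22.2$, below $16\sqrt{2\pi}\approx 40.1$.
  have hconst : 9 / 4 * Real.pi ^ 2 ≤ 16 * √(2 * Real.pi) := by
    have h1 : (5 / 2 : ℝ) ≤ √(2 * Real.pi) :=
      Real.le_sqrt_of_sq_le (by nlinarith [Real.pi_gt_d2])
    nlinarith [Real.pi_lt_d2, Real.pi_pos]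
  have hin : ∀ s, ∫ v, ‖G.zerothOrder η i x s v‖ ^ 2 ∂(sphereUniform (n i) η) ≤
      16 * √(2 * Real.pi) * (Lip i : ℝ) ^ 2 * n i := by
    intro s
    obtain ⟨g, hg, hgv⟩ := hG.exists_extension hx i s
    have e : ∫ v, ‖G.zerothOrder η i x s v‖ ^ 2 ∂(sphereUniform (n i) η) =
        ((n i : ℝ) / (2 * η)) ^ 2 * ∫ v, (g (x i + v) - g (x i - v)) ^ 2 ∂(sphereUniform (n i) η) := by
      rw [← integral_const_mul]
      refine integral_congr_ae ?_
      filter_upwards [ae_norm_eq_sphereUniform hη] with v hv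
      rw [norm_zerothOrder_sq hη i s hv, (hgv v hv).1, (hgv v hv).2]
    rw [e]
    calc _ ≤ ((n i : ℝ) / (2 * η)) ^ 2 * (9 * Real.pi ^ 2 * Lip i ^ 2 * η ^ 2 / n i) := by
          gcongr
          exact integral_sq_sub_sphereUniform_le (hn i) hη hg (x i)
      _ = (9 / 4 * Real.pi ^ 2) * (Lip i ^ 2 * n i) := by field_simp; ring
      _ ≤ (16 * √(2 * Real.pi)) * (Lip i ^ 2 * n i) := by gcongr
      _ = _ := by ring
  refine (integral_mono hint.integral_prod_left (integrable_const _) hin).trans ?_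
  simp

/-- Integrating over the sample first replaces $\tilde h_i$ by $h_i$. By antipodal symmetry both
halves of the symmetric difference contribute equally, which turns $n_i/(2\eta)$ into the factor
$n_i/\eta$ of the one-sided formula. -/
theorem IsLipschitzGame.hasGradientAt_smoothing (hG : G.IsLipschitzGame μ η Lip) (hη : 0 < η)
    (hn : ∀ i, 0 < n i) {x : Profile n} (hx : x ∈ G.feasible) (i : Fin N) :
    HasGradientAt (smoothing η (G.h μ i))
      (∫ p, G.zerothOrder η i x p.1 p.2 ∂(μ.prod (sphereUniform (n i) η))) (x i) := by
  have := isProbabilityMeasure_sphereUniform (hn i) η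
  obtain ⟨U, hU, hXU, hLip, hint⟩ := hG.lipschitz i
  have hhU : LipschitzOnWith (Lip i) (G.h μ i) U := by
    refine LipschitzOnWith.of_dist_le_mul fun y hy z hz => ?_
    rw [h, h, dist_eq_norm, ← integral_sub (hint y hy) (hint z hz)]
    refine (norm_integral_le_of_norm_le_const (Eventually.of_forall fun s => ?_)).trans_eq (by simp; rfl)
    have := (hLip s).dist_le_mul y hy z hz
    rwa [dist_eq_norm (G.ht i y s)] at this
  have hball : Metric.closedBall (x i) η ⊆ U := fun y hy => hXU <| by
    rw [← add_sub_cancel (x i) y]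
    exact add_mem_add (hx i) (by simpa [dist_eq_norm] using hy)
  have hmemU : ∀ v : Strat (n i), ‖v‖ = η → x i + v ∈ U := fun v hv => hball (by simp [hv])
  have hmemU' : ∀ v : Strat (n i), ‖v‖ = η → x i - v ∈ U := fun v hv => hball (by simp [hv])
  obtain ⟨g, hg, hgU⟩ := hhU.extend_real
  have hmain := _root_.hasGradientAt_smoothing (hn i) hη hU hhU hball
  convert hmain using 1
  have hzint := (hG.memLp_zerothOrder hη hn hx i).integrable (by norm_num)
  rw [integral_prod_symm _ hzint]
  have hgcont : Continuous fun v => g (x i + v) := hg.continuous.comp (by fun_prop)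
  have hgcont' : Continuous fun v => g (x i - v) := hg.continuous.comp (by fun_prop)
  have hgi : ∀ f : Strat (n i) → ℝ, Continuous f → Integrable
      (fun v => ((n i : ℝ) / (2 * η) * f v) • (‖v‖⁻¹ • v)) (sphereUniform (n i) η) := by
    intro f hf
    obtain ⟨C, hC⟩ := ((isCompact_closedBall (0 : Strat (n i)) η).bddAbove_image hf.norm.continuousOn)
    refine Integrable.of_bound (C := (n i : ℝ) / (2 * η) * C) ?_ ?_
    · exact (hf.measurable.const_mul _).smul (measurable_norm.inv.smul measurable_id)
        |>.aestronglyMeasurable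
    · filter_upwards [ae_norm_eq_sphereUniform hη] with v hv
      rw [norm_smul, norm_smul, norm_inv, norm_norm, hv, inv_mul_cancel₀ hη.ne', mul_one, norm_mul,
        Real.norm_of_nonneg (by positivity)]
      gcongr
      exact hC ⟨v, by simp [hv], rfl⟩
  have h1 : ∫ v, ∫ s, G.zerothOrder η i x s v ∂μ ∂(sphereUniform (n i) η) =
      ∫ v, (((n i : ℝ) / (2 * η) * g (x i + v)) • (‖v‖⁻¹ • v) -
        ((n i : ℝ) / (2 * η) * g (x i - v)) • (‖v‖⁻¹ • v)) ∂(sphereUniform (n i) η) := by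
    refine integral_congr_ae ?_
    filter_upwards [ae_norm_eq_sphereUniform hη] with v hv
    simp only [zerothOrder]
    rw [integral_smul_const, integral_const_mul, integral_sub (hint _ (hmemU v hv))
      (hint _ (hmemU' v hv)), ← hgU (hmemU v hv), ← hgU (hmemU' v hv), mul_sub, sub_smul]
    rfl
  have h2 : ∫ v, ((n i : ℝ) / (2 * η) * g (x i - v)) • (‖v‖⁻¹ • v) ∂(sphereUniform (n i) η) =
      - ∫ v, ((n i : ℝ) / (2 * η) * g (x i + v)) • (‖v‖⁻¹ • v) ∂(sphereUniform (n i) η) := by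
    rw [← integral_neg_sphereUniform hη, ← integral_neg]
    refine integral_congr_ae (Eventually.of_forall fun v => ?_)
    simp
  rw [h1, integral_sub (hgi _ hgcont) (hgi _ hgcont'), h2, sub_neg_eq_add, ← integral_add
    (hgi _ hgcont) (hgi _ hgcont)]
  refine integral_congr_ae ?_
  filter_upwards [ae_norm_eq_sphereUniform hη] with v hv
  rw [hgU (hmemU v hv), ← add_smul]
  congr 1
  field_simp
  ring

variable {σm : ℝ}

/-- The gradient field of the smoothed game, by players. -/
theorem IsLipschitzGame.hasGradientAt_fSmooth (hG : G.IsLipschitzGame μ η Lip) (hη : 0 < η)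
    (hn : ∀ i, 0 < n i) (hU : G.Unbiased μ) {x : Profile n} (hx : x ∈ G.feasible) (i : Fin N) :
    HasGradientAt (fun y => G.fSmooth μ η i (deviate x i y))
      (∫ p, G.zerothOrder η i x p.1 p.2 ∂(μ.prod (sphereUniform (n i) η)) +
        gradient (fun y => G.m μ i (deviate x i y)) (x i)) (x i) := by
  have h1 := (hG.hasGradientAt_smoothing hη hn hx i).hasFDerivAt.add
    ((hU i x hx).1.hasGradientAt).hasFDerivAt
  rw [← map_add, ← hasGradientAt_iff_hasFDerivAt] at h1
  simpa [fSmooth, Pi.add_def] using h1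

theorem IsLipschitzGame.hasGradientAt_FSmooth (hG : G.IsLipschitzGame μ η Lip) (hη : 0 < η)
    (hn : ∀ i, 0 < n i) (hU : G.Unbiased μ) {x : Profile n} (hx : x ∈ G.feasible) (i : Fin N) :
    HasGradientAt (fun y => G.fSmooth μ η i (deviate x i y)) (G.FSmooth μ η x i) (x i) :=
  (hG.hasGradientAt_fSmooth hη hn hU hx i).differentiableAt.hasGradientAt

theorem IsLipschitzGame.FSmooth_apply (hG : G.IsLipschitzGame μ η Lip) (hη : 0 < η)
    (hn : ∀ i, 0 < n i) (hU : G.Unbiased μ) {x : Profile n} (hx : x ∈ G.feasible) (i : Fin N) :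
    G.FSmooth μ η x i = ∫ p, G.zerothOrder η i x p.1 p.2 ∂(μ.prod (sphereUniform (n i) η)) +
        gradient (fun y => G.m μ i (deviate x i y)) (x i) :=
  (hG.hasGradientAt_fSmooth hη hn hU hx i).gradient

/-- The zeroth- and first-order parts share the sample $\xi$ and may be correlated, so their errors
are combined by $\|a+b\|^2\le 2\|a\|^2+2\|b\|^2$. This doubles 16 to 32 and $\sigma_m^2$ to
$2\sigma_m^2$. -/
theorem IsLipschitzGame.memLp_estimator_sub (hG : G.IsLipschitzGame μ η Lip) (hη : 0 < η)
    (hn : ∀ i, 0 < n i) (hU : G.Unbiased μ) (hB : G.BoundedSecondMoment μ σm)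
    {x : Profile n} (hx : x ∈ G.feasible) (i : Fin N) :
    MemLp (fun p => G.estimator η i x p - G.FSmooth μ η x i) 2 (μ.prod (sphereUniform (n i) η)) ∧
    ∫ p, (G.estimator η i x p - G.FSmooth μ η x i) ∂(μ.prod (sphereUniform (n i) η)) = 0 ∧
    ∫ p, ‖G.estimator η i x p - G.FSmooth μ η x i‖ ^ 2 ∂(μ.prod (sphereUniform (n i) η)) ≤
      32 * √(2 * Real.pi) * (Lip i : ℝ) ^ 2 * n i + 2 * σm ^ 2 := by
  have := isProbabilityMeasure_sphereUniform (hn i) η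
  set ν := μ.prod (sphereUniform (n i) η)
  set z0 := ∫ p, G.zerothOrder η i x p.1 p.2 ∂ν
  set m0 := gradient (fun y => G.m μ i (deviate x i y)) (x i)
  have hz : MemLp (fun p => G.zerothOrder η i x p.1 p.2) 2 ν := hG.memLp_zerothOrder hη hn hx i
  obtain ⟨-, hgi, hge⟩ := hU i x hx
  obtain ⟨hb1, hb2⟩ := hB i x hx
  have hg : MemLp (fun s => G.gradMt i x s - m0) 2 μ :=
    (memLp_two_iff_integrable_sq_norm (hgi.sub (integrable_const _)).aestronglyMeasurable).2 hb1
  have hg' : MemLp (fun p : Ξ × Strat (n i) => G.gradMt i x p.1 - m0) 2 ν := hg.comp_fst _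
  have hz' : MemLp (fun p : Ξ × Strat (n i) => G.zerothOrder η i x p.1 p.2 - z0) 2 ν :=
    hz.sub (memLp_const _)
  have hsplit : ∀ p, G.estimator η i x p - G.FSmooth μ η x i =
      (G.zerothOrder η i x p.1 p.2 - z0) + (G.gradMt i x p.1 - m0) := by
    intro p
    rw [hG.FSmooth_apply hη hn hU hx, estimator]
    abel
  have hzI : ∫ p, (G.zerothOrder η i x p.1 p.2 - z0) ∂ν = 0 := by
    rw [integral_sub (hz.integrable (by norm_num)) (integrable_const _)]
    simp [z0]
  have hgI : ∫ p : Ξ × Strat (n i), (G.gradMt i x p.1 - m0) ∂ν = 0 := by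
    rw [integral_fun_fst (fun s => G.gradMt i x s - m0), integral_sub hgi (integrable_const _), hge]
    simp [m0]
  simp_rw [hsplit]
  refine ⟨hz'.add hg', ?_, ?_⟩
  · rw [integral_add (hz'.integrable (by norm_num)) (hg'.integrable (by norm_num)), hzI, hgI,
      add_zero]
  · have hvar := integral_norm_sub_integral_sq_le hz
    have hbz := hG.integral_zerothOrder_sq_le hη hn hx i
    have hbg : ∫ p : Ξ × Strat (n i), ‖G.gradMt i x p.1 - m0‖ ^ 2 ∂ν ≤ σm ^ 2 := by
      rw [integral_fun_fst (fun s => ‖G.gradMt i x s - m0‖ ^ 2)]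
      simpa using hb2
    have hmono := integral_mono (μ := ν) (hz'.add hg').norm.integrable_sq
      ((hz'.norm.integrable_sq.const_mul 2).add (hg'.norm.integrable_sq.const_mul 2)) fun p => by
        have h1 := norm_add_le (G.zerothOrder η i x p.1 p.2 - z0) (G.gradMt i x p.1 - m0)
        have h2 := norm_nonneg ((G.zerothOrder η i x p.1 p.2 - z0) + (G.gradMt i x p.1 - m0))
        simp only [Pi.add_apply]
        nlinarith [sq_nonneg (‖G.zerothOrder η i x p.1 p.2 - z0‖ - ‖G.gradMt i x p.1 - m0‖)]
    simp only [Pi.add_apply] at hmono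
    rw [integral_add (hz'.norm.integrable_sq.const_mul 2) (hg'.norm.integrable_sq.const_mul 2),
      integral_const_mul, integral_const_mul] at hmono
    linarith

end StochGame

theorem integrable_inner_of_memLp_two {Ω E : Type*} [MeasurableSpace Ω] {P : Measure Ω}
    [NormedAddCommGroup E] [InnerProductSpace ℝ E] {f g : Ω → E} (hf : MemLp f 2 P)
    (hg : MemLp g 2 P) : Integrable (fun ω => inner ℝ (f ω) (g ω)) P :=
  (hf.norm.integrable_mul hg.norm).mono (hf.1.inner hg.1)
    (Eventually.of_forall fun ω => by simpa using norm_inner_le_norm (𝕜 := ℝ) (f ω) (g ω))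

/-! ### Mini-batch averages and conditioning on the past. -/

section Averaging
variable {Ω A E : Type*} [MeasurableSpace Ω] [MeasurableSpace A] {P : Measure Ω}
  [IsProbabilityMeasure P] [NormedAddCommGroup E] [InnerProductSpace ℝ E] [CompleteSpace E]

/-- Averages of i.i.d. centred samples: moments of order one and two. -/
theorem memLp_sampleMean {S : ℕ} (hS : 0 < S) {W : Fin S → Ω → A} {ν : Measure A}
    [IsProbabilityMeasure ν] (hW : ∀ l, Measurable (W l)) (hlaw : ∀ l, P.map (W l) = ν)
    (hind : iIndepFun W P) {Z : A → E} (hZ : MemLp Z 2 ν) (hZ0 : ∫ a, Z a ∂ν = 0) {V : ℝ}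
    (hV : ∫ a, ‖Z a‖ ^ 2 ∂ν ≤ V) :
    MemLp (fun ω => (S : ℝ)⁻¹ • ∑ l, Z (W l ω)) 2 P ∧
    ∫ ω, (S : ℝ)⁻¹ • ∑ l, Z (W l ω) ∂P = 0 ∧
    ∫ ω, ‖(S : ℝ)⁻¹ • ∑ l, Z (W l ω)‖ ^ 2 ∂P ≤ V / S := by
  have hmp : ∀ l, MeasurePreserving (W l) P ν := fun l => ⟨hW l, hlaw l⟩
  have hZl : ∀ l, MemLp (fun ω => Z (W l ω)) 2 P := fun l => hZ.comp_measurePreserving (hmp l)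
  have hI : ∀ l, ∫ ω, Z (W l ω) ∂P = 0 := fun l => by
    rw [← hZ0, ← hlaw l, integral_map (hW l).aemeasurable]
    rw [hlaw l]; exact hZ.1
  have hsq : ∀ l, ∫ ω, ‖Z (W l ω)‖ ^ 2 ∂P ≤ V := fun l => by
    refine le_trans (le_of_eq ?_) hV
    rw [← hlaw l, integral_map (hW l).aemeasurable]
    rw [hlaw l]; exact hZ.norm.integrable_sq.1
  have hinner : ∀ l m, Integrable (fun ω => inner ℝ (Z (W l ω)) (Z (W m ω))) P := fun l m =>
    integrable_inner_of_memLp_two (hZl l) (hZl m)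
  -- Independence and centring kill the off-diagonal terms, leaving `S` diagonal ones against the
  -- factor $S^{-2}$.
  have hcross : ∀ l m, l ≠ m → ∫ ω, inner ℝ (Z (W l ω)) (Z (W m ω)) ∂P = 0 := fun l m hlm => by
    have hp := (indepFun_iff_map_prod_eq_prod_map_map (hW l).aemeasurable (hW m).aemeasurable).1
      (hind.indepFun hlm)
    rw [hlaw, hlaw] at hp
    have hpm : MeasurePreserving (fun ω => (W l ω, W m ω)) P (ν.prod ν) :=
      ⟨(hW l).prodMk (hW m), hp⟩
    have hZ1 : MemLp (fun p : A × A => Z p.1) 2 (ν.prod ν) := hZ.comp_fst ν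
    have hZ2 : MemLp (fun p : A × A => Z p.2) 2 (ν.prod ν) := hZ.comp_snd ν
    have hint : Integrable (fun p : A × A => inner ℝ (Z p.1) (Z p.2)) (ν.prod ν) :=
      integrable_inner_of_memLp_two hZ1 hZ2
    have e : ∫ ω, inner ℝ (Z (W l ω)) (Z (W m ω)) ∂P =
        ∫ p, inner ℝ (Z p.1) (Z p.2) ∂(ν.prod ν) := by
      rw [← hp, integral_map hpm.measurable.aemeasurable]
      rw [hp]; exact hint.1
    rw [e, integral_prod _ hint]
    simp_rw [integral_inner (hZ.integrable (by norm_num)), hZ0, inner_zero_right]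
    simp
  have hsum : MemLp (fun ω => ∑ l, Z (W l ω)) 2 P := memLp_finsetSum _ fun l _ => hZl l
  refine ⟨hsum.const_smul _, ?_, ?_⟩
  · rw [integral_smul, integral_finsetSum _ fun l _ => (hZl l).integrable (by norm_num)]
    simp [hI]
  · have hS' : (0 : ℝ) < S := by exact_mod_cast hS
    have e : ∀ ω, ‖(S : ℝ)⁻¹ • ∑ l, Z (W l ω)‖ ^ 2 =
        ((S : ℝ)⁻¹) ^ 2 * ∑ l, ∑ m, inner ℝ (Z (W l ω)) (Z (W m ω)) := fun ω => by
      rw [norm_smul, mul_pow, ← real_inner_self_eq_norm_sq (∑ l, Z (W l ω)), sum_inner]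
      simp_rw [inner_sum]
      simp
    simp_rw [e]
    rw [integral_const_mul, integral_finsetSum _ fun l _ => integrable_finsetSum _ fun m _ =>
      hinner l m]
    have hrow : ∀ l, ∫ ω, ∑ m, inner ℝ (Z (W l ω)) (Z (W m ω)) ∂P ≤ V := fun l => by
      rw [integral_finsetSum _ fun m _ => hinner l m, Finset.sum_eq_single l
        (fun m _ hm => hcross l m hm.symm) (by simp)]
      simpa using hsq l
    calc _ ≤ ((S : ℝ)⁻¹) ^ 2 * ∑ _l : Fin S, V := by
          gcongr with l
          exact hrow l
      _ = V / S := by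
          simp
          field_simp

/-- Conditioning on an independent variable, for a noise term that is centred and has bounded
second moment given the value of that variable. -/
theorem integral_noise {𝒳 𝒲 : Type*} [MeasurableSpace 𝒳] [MeasurableSpace 𝒲]
    [MeasurableSpace E] [BorelSpace E] [SecondCountableTopology E]
    {X : Ω → 𝒳} {W : Ω → 𝒲} (hX : Measurable X) (hW : Measurable W) (hXW : IndepFun X W P)
    {K : Set 𝒳} (hK : ∀ ω, X ω ∈ K) (hKm : MeasurableSet K) {Φ : 𝒳 × 𝒲 → E} (hΦ : Measurable Φ)
    {b : 𝒳 → E} (hb : Measurable b) {C V : ℝ} (hbC : ∀ x, ‖b x‖ ≤ C)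
    (h2 : ∀ x ∈ K, MemLp (fun ω => Φ (x, W ω)) 2 P) (h0 : ∀ x ∈ K, ∫ ω, Φ (x, W ω) ∂P = 0)
    (hV : ∀ x ∈ K, ∫ ω, ‖Φ (x, W ω)‖ ^ 2 ∂P ≤ V) :
    Integrable (fun ω => ‖Φ (X ω, W ω)‖ ^ 2) P ∧ ∫ ω, ‖Φ (X ω, W ω)‖ ^ 2 ∂P ≤ V ∧
    Integrable (fun ω => inner ℝ (Φ (X ω, W ω)) (b (X ω))) P ∧
    ∫ ω, inner ℝ (Φ (X ω, W ω)) (b (X ω)) ∂P = 0 := by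
  set lam := P.map X
  set Lam := P.map W
  have : IsProbabilityMeasure lam := Measure.isProbabilityMeasure_map hX.aemeasurable
  have : IsProbabilityMeasure Lam := Measure.isProbabilityMeasure_map hW.aemeasurable
  -- The joint law is a product, so Fubini with `x ∈ K` frozen plays the role of conditional
  -- expectation.
  have hp : P.map (fun ω => (X ω, W ω)) = lam.prod Lam :=
    (indepFun_iff_map_prod_eq_prod_map_map hX.aemeasurable hW.aemeasurable).1 hXW
  have hpm : MeasurePreserving (fun ω => (X ω, W ω)) P (lam.prod Lam) := ⟨hX.prodMk hW, hp⟩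
  have hWm : MeasurePreserving W P Lam := ⟨hW, rfl⟩
  have hKae : ∀ᵐ x ∂lam, x ∈ K := (ae_map_iff hX.aemeasurable hKm).2 (Eventually.of_forall hK)
  have hΦx : ∀ x, Measurable (fun y => Φ (x, y)) := fun x => hΦ.comp measurable_prodMk_left
  have h2' : ∀ x ∈ K, MemLp (fun y => Φ (x, y)) 2 Lam := fun x hx =>
    (memLp_map_measure_iff (hΦx x).aestronglyMeasurable hW.aemeasurable).2 (h2 x hx)
  have hV' : ∀ x ∈ K, ∫ y, ‖Φ (x, y)‖ ^ 2 ∂Lam ≤ V := fun x hx => by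
    rw [integral_map hW.aemeasurable ((hΦx x).norm.pow_const 2).aestronglyMeasurable]
    exact hV x hx
  have h0' : ∀ x ∈ K, ∫ y, Φ (x, y) ∂Lam = 0 := fun x hx => by
    rw [integral_map hW.aemeasurable (hΦx x).aestronglyMeasurable]
    exact h0 x hx
  have hsqm : Measurable (fun p => ‖Φ p‖ ^ 2) := hΦ.norm.pow_const 2
  have hsqint : Integrable (fun p => ‖Φ p‖ ^ 2) (lam.prod Lam) := by
    rw [integrable_prod_iff hsqm.aestronglyMeasurable]
    refine ⟨hKae.mono fun x hx => (h2' x hx).norm.integrable_sq, ?_⟩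
    refine Integrable.of_bound (C := V) ?_ (hKae.mono fun x hx => ?_)
    · exact (hsqm.norm.stronglyMeasurable.integral_prod_right).aestronglyMeasurable
    · simp only [norm_pow, norm_norm]
      rw [Real.norm_of_nonneg (integral_nonneg fun _ => by positivity)]
      exact hV' x hx
  have hL2 : MemLp Φ 2 (lam.prod Lam) :=
    (memLp_two_iff_integrable_sq_norm hΦ.aestronglyMeasurable).2 hsqint
  have hbL : MemLp (fun p : 𝒳 × 𝒲 => b p.1) 2 (lam.prod Lam) :=
    MemLp.of_bound (hb.comp measurable_fst).aestronglyMeasurable C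
      (Eventually.of_forall fun p => hbC p.1)
  have hin : Integrable (fun p : 𝒳 × 𝒲 => inner ℝ (Φ p) (b p.1)) (lam.prod Lam) :=
    integrable_inner_of_memLp_two hL2 hbL
  refine ⟨hpm.integrable_comp_of_integrable hsqint, ?_, hpm.integrable_comp_of_integrable hin, ?_⟩
  · have e : ∫ ω, ‖Φ (X ω, W ω)‖ ^ 2 ∂P = ∫ p, ‖Φ p‖ ^ 2 ∂(lam.prod Lam) := by
      rw [← hp, integral_map hpm.measurable.aemeasurable hsqm.aestronglyMeasurable]
    rw [e, integral_prod _ hsqint]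
    refine (integral_mono_ae hsqint.integral_prod_left (integrable_const V)
      (hKae.mono fun x hx => hV' x hx)).trans ?_
    simp
  · have e : ∫ ω, inner ℝ (Φ (X ω, W ω)) (b (X ω)) ∂P =
        ∫ p, inner ℝ (Φ p) (b p.1) ∂(lam.prod Lam) := by
      rw [← hp, integral_map hpm.measurable.aemeasurable]
      rw [hp]; exact hin.1
    rw [e, integral_prod _ hin]
    refine integral_eq_zero_of_ae (hKae.mono fun x hx => ?_)
    simp only [Pi.zero_apply]
    simp_rw [real_inner_comm (b x)]
    rw [integral_inner ((h2' x hx).integrable (by norm_num)), h0' x hx, inner_zero_right]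

end Averaging

/-! ### Deterministic estimates for one projected step. -/

section Step
variable {E : Type*} [NormedAddCommGroup E] [InnerProductSpace ℝ E] [CompleteSpace E]

/-- The descent lemma, for a gradient relative to a convex set and a field which agrees with it on
feasible directions. -/
theorem le_of_lipschitz_gradientWithin {X : Set E} (hX : Convex ℝ X) {P : E → ℝ} {L : ℝ}
    {g F : E → E} (hg : ∀ x ∈ X, HasGradientWithinAt P (g x) X x)
    (hL : ∀ x ∈ X, ∀ y ∈ X, ‖g x - g y‖ ≤ L * ‖x - y‖)
    (hF : ∀ x ∈ X, ∀ z ∈ X, inner ℝ (F x) (z - x) = inner ℝ (g x) (z - x))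
    {x y : E} (hx : x ∈ X) (hy : y ∈ X) :
    P y ≤ P x + inner ℝ (F x) (y - x) + L / 2 * ‖y - x‖ ^ 2 := by
  rw [hF x hx y hy]
  have hmem : ∀ t ∈ Icc (0 : ℝ) 1, x + t • (y - x) ∈ X := fun t ht =>
    hX.add_smul_sub_mem hx hy ht
  have hder : ∀ t ∈ Icc (0 : ℝ) 1, HasDerivWithinAt (fun t : ℝ => P (x + t • (y - x)))
      (inner ℝ (g (x + t • (y - x))) (y - x)) (Icc 0 1) t := by
    intro t ht
    have h1 : HasDerivWithinAt (fun t : ℝ => x + t • (y - x)) (y - x) (Icc 0 1) t := by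
      have := ((hasDerivAt_id t).smul_const (y - x)).const_add x
      simpa using this.hasDerivWithinAt
    have h2 := (hg _ (hmem t ht)).hasFDerivWithinAt.comp_hasDerivWithinAt t h1 hmem
    simpa [Function.comp_def] using h2
  -- The quadratic whose derivative dominates that of `P` along the segment, by the Lipschitz bound
  -- on `g`. One-sided derivatives suffice for the comparison, so a gradient within `X` is enough.
  let B : ℝ → ℝ := fun t => P x + t * inner ℝ (g x) (y - x) + L * ‖y - x‖ ^ 2 * (t ^ 2 / 2)
  have hB : ∀ t, HasDerivAt B (inner ℝ (g x) (y - x) + L * ‖y - x‖ ^ 2 * t) t := by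
    intro t
    have := ((((hasDerivAt_id t).mul_const (inner ℝ (g x) (y - x))).const_add (P x))).add
      (((hasDerivAt_pow 2 t).div_const 2).const_mul (L * ‖y - x‖ ^ 2))
    refine HasDerivAt.congr_deriv this ?_
    simp
  have key := image_le_of_deriv_right_le_deriv_boundary (a := 0) (b := 1)
    (f := fun t : ℝ => P (x + t • (y - x)))
    (f' := fun t => inner ℝ (g (x + t • (y - x))) (y - x)) (B := B)
    (B' := fun t => inner ℝ (g x) (y - x) + L * ‖y - x‖ ^ 2 * t)
    (fun t ht => (hder t ht).continuousWithinAt)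
    (fun t ht => ((hder t ⟨ht.1, ht.2.le⟩).mono_of_mem_nhdsWithin
      (Icc_mem_nhdsGE_of_mem ht)))
    (by simp [B]) (fun t _ => (hB t).continuousAt.continuousWithinAt)
    (fun t _ => (hB t).hasDerivWithinAt) (fun t ht => by
      have h1 := hL _ (hmem t ⟨ht.1, ht.2.le⟩) x hx
      have h2 := real_inner_le_norm (g (x + t • (y - x)) - g x) (y - x)
      rw [inner_sub_left] at h2
      rw [add_sub_cancel_left, norm_smul, Real.norm_of_nonneg ht.1] at h1
      have h3 := mul_le_mul_of_nonneg_right h1 (norm_nonneg (y - x))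
      nlinarith) (right_mem_Icc.2 zero_le_one)
  simp only [one_smul, add_sub_cancel, B] at key
  linarith

variable {X : Set E} {P : E → ℝ} {L : ℝ} {F : E → E}

-- Testing the projection inequality at `z = x` gives $\langle F(x),x-q\rangle\ge 2L\|x-q\|^2$, and
-- $2L-L/2=3L/2$.
omit [CompleteSpace E] in
theorem norm_sub_sq_le_of_descent (hL : 0 < L)
    (hdesc : ∀ x ∈ X, ∀ y ∈ X, P y ≤ P x + inner ℝ (F x) (y - x) + L / 2 * ‖y - x‖ ^ 2)
    {x q : E} (hx : x ∈ X) (hq : q ∈ X)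
    (hqv : ∀ z ∈ X, inner ℝ (x - (1 / (2 * L)) • F x - q) (z - q) ≤ 0) :
    3 * L / 2 * ‖x - q‖ ^ 2 ≤ P x - P q := by
  have h1 := hdesc x hx q hq
  have h2 := hqv x hx
  rw [sub_right_comm, inner_sub_left, real_inner_self_eq_norm_sq, real_inner_smul_left] at h2
  have h3 : inner ℝ (F x) (q - x) = - inner ℝ (F x) (x - q) := by rw [← inner_neg_right, neg_sub]
  rw [h3, norm_sub_rev q x] at h1
  have h4 : 2 * L * (1 / (2 * L) * inner ℝ (F x) (x - q)) = inner ℝ (F x) (x - q) := by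
    field_simp
  nlinarith

omit [CompleteSpace E] in
/-- One step of the projected method with an inexact direction `D`. -/
theorem norm_sub_sq_le_of_inexact_descent (hL : 0 < L)
    (hdesc : ∀ x ∈ X, ∀ y ∈ X, P y ≤ P x + inner ℝ (F x) (y - x) + L / 2 * ‖y - x‖ ^ 2)
    {x p q D : E} (hx : x ∈ X) (hp : p ∈ X) (hq : q ∈ X)
    (hpv : ∀ z ∈ X, inner ℝ (x - (1 / (2 * L)) • D - p) (z - p) ≤ 0)
    (hqv : ∀ z ∈ X, inner ℝ (x - (1 / (2 * L)) • F x - q) (z - q) ≤ 0) :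
    3 * L / 4 * ‖x - q‖ ^ 2 ≤
      P x - P p + 7 / (8 * L) * ‖D - F x‖ ^ 2 - inner ℝ (D - F x) (q - x) := by
  have h1 := hdesc x hx p hp
  have h2 := hpv x hx
  rw [sub_right_comm, inner_sub_left, real_inner_self_eq_norm_sq, real_inner_smul_left] at h2
  have h4 : 2 * L * (1 / (2 * L) * inner ℝ D (x - p)) = inner ℝ D (x - p) := by
    field_simp
  have h5 : ‖p - q‖ ≤ 1 / (2 * L) * ‖D - F x‖ := by
    have := norm_sub_le_of_variational hp hq hpv hqv
    rwa [sub_sub_sub_cancel_left, ← smul_sub, norm_smul, Real.norm_of_nonneg (by positivity),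
      norm_sub_rev (F x)] at this
  -- The error is tested against `q - x`, which depends on `x` only and will average out, and
  -- against `p - q`, which depends on the batch and is paid for by nonexpansiveness (`h5`).
  have h6 : inner ℝ (F x) (p - x) =
      - inner ℝ D (x - p) - inner ℝ (D - F x) (q - x) - inner ℝ (D - F x) (p - q) := by
    simp only [inner_sub_left, inner_sub_right]
    ring
  have h7 : - inner ℝ (D - F x) (p - q) ≤ 1 / (2 * L) * ‖D - F x‖ ^ 2 := by
    have := abs_le.1 (abs_real_inner_le_norm (D - F x) (p - q))
    have h8 := mul_le_mul_of_nonneg_left h5 (norm_nonneg (D - F x))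
    nlinarith
  have h9 : ‖x - q‖ ≤ ‖x - p‖ + ‖p - q‖ := norm_sub_le_norm_sub_add_norm_sub x p q
  have h10 : ‖x - q‖ ^ 2 ≤ 2 * ‖x - p‖ ^ 2 + 2 * (1 / (2 * L) * ‖D - F x‖) ^ 2 := by
    have h11 : ‖x - q‖ ≤ ‖x - p‖ + 1 / (2 * L) * ‖D - F x‖ := by linarith
    have h12 := pow_le_pow_left₀ (norm_nonneg _) h11 2
    nlinarith [sq_nonneg (‖x - p‖ - 1 / (2 * L) * ‖D - F x‖)]
  have h13 : 3 * L / 4 * ‖x - q‖ ^ 2 ≤ 3 * L / 2 * ‖x - p‖ ^ 2 + 3 / (8 * L) * ‖D - F x‖ ^ 2 := by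
    have := mul_le_mul_of_nonneg_left h10 (show 0 ≤ 3 * L / 4 by positivity)
    refine this.trans_eq ?_
    field_simp
    ring
  -- The $3/8$ comes from passing from `p` to `q` in the squared distance, the $1/2$ from the
  -- product with `p - q`.
  have h14 : 7 / (8 * L) * ‖D - F x‖ ^ 2 =
      3 / (8 * L) * ‖D - F x‖ ^ 2 + 1 / (2 * L) * ‖D - F x‖ ^ 2 := by
    field_simp
    ring
  rw [norm_sub_rev p x] at h1
  nlinarith

end Step

/-! ### The potential, the gradient field and the batch error. -/

namespace StochGame
variable {N : ℕ} {n : Fin N → ℕ} {Ξ : Type*} [MeasurableSpace Ξ] {G : StochGame n Ξ}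
  {μ : Measure Ξ} [IsProbabilityMeasure μ] {η σm : ℝ} {Lip : Fin N → ℝ≥0}

/-- Along feasible directions, a gradient of a potential within the feasible set agrees with the
gradient field of the smoothed game. -/
theorem IsSmoothedPotential.inner_FSmooth_eq {P : Profile n → ℝ}
    (hP : G.IsSmoothedPotential μ η P) (hG : G.IsLipschitzGame μ η Lip) (hη : 0 < η)
    (hn : ∀ i, 0 < n i) (hU : G.Unbiased μ) {g x z : Profile n} (hx : x ∈ G.feasible)
    (hz : z ∈ G.feasible) (hg : HasGradientWithinAt P g G.feasible x) :
    inner ℝ (G.FSmooth μ η x) (z - x) = inner ℝ g (z - x) := by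
  rw [PiLp.inner_apply, PiLp.inner_apply]
  refine Finset.sum_congr rfl fun i _ => ?_
  have hmem : ∀ t ∈ Icc (0 : ℝ) 1, x i + t • (z i - x i) ∈ G.X i := fun t ht =>
    (hG.convex i).add_smul_sub_mem (hx i) (hz i) ht
  have h0 : (0 : ℝ) ∈ Icc (0 : ℝ) 1 := left_mem_Icc.2 zero_le_one
  have hline : HasDerivAt (fun t : ℝ => x i + t • (z i - x i)) (z i - x i) 0 := by
    have := ((hasDerivAt_id (0 : ℝ)).smul_const (z i - x i)).const_add (x i)
    simpa using this
  have hdev : ∀ t : ℝ, deviate x i (x i + t • (z i - x i)) = x + t • (deviate x i (z i) - x) := by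
    intro t
    ext j : 1
    rcases eq_or_ne j i with rfl | hj
    · simp
    · simp [deviate_of_ne x hj]
  have hinner : inner ℝ g (deviate x i (z i) - x) = inner ℝ (g i) (z i - x i) := by
    rw [PiLp.inner_apply, Finset.sum_eq_single i]
    · simp
    · intro j _ hj
      simp [deviate_of_ne x hj]
    · simp
  -- The potential along a feasible segment in the `i`-th coordinate is differentiated twice over:
  -- by the chain rule through `g`, and through the objective of player `i`. Uniqueness of
  -- derivatives within $[0,1]$ equates the results, also at boundary points of the strategy set.
  have d1 : HasDerivWithinAt (fun t : ℝ => P (deviate x i (x i + t • (z i - x i))))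
      (inner ℝ (g i) (z i - x i)) (Icc 0 1) 0 := by
    have hl : HasDerivWithinAt (fun t : ℝ => x + t • (deviate x i (z i) - x))
        (deviate x i (z i) - x) (Icc 0 1) 0 := by
      have := ((hasDerivAt_id (0 : ℝ)).smul_const (deviate x i (z i) - x)).const_add x
      simpa using this.hasDerivWithinAt
    have hg' : HasFDerivWithinAt P (InnerProductSpace.toDual ℝ _ g) G.feasible
        (x + (0 : ℝ) • (deviate x i (z i) - x)) := by
      simpa using hg.hasFDerivWithinAt
    have := hg'.comp_hasDerivWithinAt (0 : ℝ) hl (fun t ht => by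
      rw [← hdev]
      exact deviate_mem_feasible hx (hmem t ht))
    simp_rw [hdev]
    simpa [Function.comp_def, hinner] using this
  have d2 : HasDerivWithinAt (fun t : ℝ => P (deviate x i (x i + t • (z i - x i))))
      (inner ℝ (G.FSmooth μ η x i) (z i - x i)) (Icc 0 1) 0 := by
    have hF : HasFDerivAt (fun y => G.fSmooth μ η i (deviate x i y))
        (InnerProductSpace.toDual ℝ _ (G.FSmooth μ η x i)) (x i + (0 : ℝ) • (z i - x i)) := by
      simpa using (hG.hasGradientAt_FSmooth hη hn hU hx i).hasFDerivAt
    have h1 := (hF.comp_hasDerivAt (0 : ℝ) hline).hasDerivWithinAt (s := Icc 0 1)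
    have h2 : HasDerivWithinAt (fun t : ℝ => (P x - G.fSmooth μ η i x) +
        G.fSmooth μ η i (deviate x i (x i + t • (z i - x i))))
        (inner ℝ (G.FSmooth μ η x i) (z i - x i)) (Icc 0 1) 0 := by
      have := h1.const_add (P x - G.fSmooth μ η i x)
      simpa only [Function.comp_def, InnerProductSpace.toDual_apply_apply] using this
    refine h2.congr (fun t ht => ?_) ?_
    · have := hP i x hx _ (hmem t ht) _ (hx i)
      simp only [deviate_self] at this
      linarith
    · simp
  exact ((uniqueDiffOn_Icc zero_lt_one) 0 h0).eq_deriv _ d2 d1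

/-- The gradient field of the smoothed game is measurable on the feasible set. -/
theorem IsLipschitzGame.measurable_FSmooth (hG : G.IsLipschitzGame μ η Lip) (hη : 0 < η)
    (hn : ∀ i, 0 < n i) (hU : G.Unbiased μ) (hB : G.BoundedSecondMoment μ σm) :
    Measurable (G.feasible.indicator (G.FSmooth μ η)) := by
  have key : ∀ i, Measurable fun x => (G.feasible.indicator (G.FSmooth μ η) x) i := by
    intro i
    have := isProbabilityMeasure_sphereUniform (hn i) η
    -- At feasible points the field is the mean of the jointly measurable estimator.
    have h := ((hG.measurable_estimator i).stronglyMeasurable.integral_prod_right'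
      (ν := μ.prod (sphereUniform (n i) η))).measurable
    convert h using 1
    ext1 x
    by_cases hx : x ∈ G.feasible
    · obtain ⟨h1, h2, -⟩ := hG.memLp_estimator_sub hη hn hU hB hx i
      have hest : Integrable (fun p => G.estimator η i x p) (μ.prod (sphereUniform (n i) η)) := by
        refine ((h1.integrable (by norm_num)).add (integrable_const (G.FSmooth μ η x i))).congr
          (Eventually.of_forall fun p => ?_)
        simp
      rw [integral_sub hest (integrable_const _)] at h2
      simp only [integral_const, probReal_univ, one_smul, sub_eq_zero] at h2
      simp [indicator, hx, h2]
    · simp [indicator, hx]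
  exact (WithLp.measurable_toLp 2 _).comp (measurable_pi_lambda _ key)

omit [IsProbabilityMeasure μ] in
theorem IsLipschitzGame.measurable_batchDirection {S : ℕ} (hG : G.IsLipschitzGame μ η Lip)
    (i : Fin N) :
    Measurable (fun q : Profile n × (Fin S → Ξ × Strat (n i)) =>
      (Prod.fst ⁻¹' G.feasible).indicator
        (fun q : Profile n × (Fin S → Ξ × Strat (n i)) => G.batchDirection η i q.1 q.2) q) := by
  have h : Measurable (fun q : Profile n × (Fin S → Ξ × Strat (n i)) => (S : ℝ)⁻¹ • ∑ l,
      (Prod.fst ⁻¹' G.feasible).indicator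
        (fun q : Profile n × Ξ × Strat (n i) => G.estimator η i q.1 q.2) (q.1, q.2 l)) := by
    refine Measurable.const_smul (Finset.measurable_sum _ fun l _ => ?_) (S : ℝ)⁻¹
    exact (hG.measurable_estimator i).comp
      (measurable_fst.prodMk ((measurable_pi_apply l).comp measurable_snd))
  convert h using 1
  ext1 q
  by_cases hq : q.1 ∈ G.feasible
  · simp [indicator, hq, batchDirection_eq]
  · simp [indicator, hq]

/-- The error of the mini-batch direction of a player at a random feasible profile independent of
the batch. -/
theorem IsLipschitzGame.integral_batch_error {Ω : Type*} [MeasurableSpace Ω] {Prb : Measure Ω}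
    [IsProbabilityMeasure Prb] {S : ℕ} (hS : 0 < S) (hG : G.IsLipschitzGame μ η Lip) (hη : 0 < η)
    (hn : ∀ i, 0 < n i) (hU : G.Unbiased μ) (hB : G.BoundedSecondMoment μ σm) (i : Fin N)
    {W : Fin S → Ω → Ξ × Strat (n i)} (hW : ∀ l, Measurable (W l))
    (hlaw : ∀ l, Prb.map (W l) = μ.prod (sphereUniform (n i) η)) (hind : iIndepFun W Prb)
    {X : Ω → Profile n} (hX : Measurable X) (hXW : IndepFun X (fun ω l => W l ω) Prb)
    (hXf : ∀ ω, X ω ∈ G.feasible) {b : Profile n → Strat (n i)} (hb : Measurable b) {C : ℝ}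
    (hbC : ∀ x, ‖b x‖ ≤ C) {V : ℝ} (hV : 32 * √(2 * Real.pi) * (Lip i : ℝ) ^ 2 * n i + 2 * σm ^ 2 ≤ V) :
    Integrable (fun ω =>
      ‖G.batchDirection η i (X ω) (fun l => W l ω) - G.FSmooth μ η (X ω) i‖ ^ 2) Prb ∧
    ∫ ω, ‖G.batchDirection η i (X ω) (fun l => W l ω) - G.FSmooth μ η (X ω) i‖ ^ 2 ∂Prb ≤ V / S ∧
    Integrable (fun ω => inner ℝ
      (G.batchDirection η i (X ω) (fun l => W l ω) - G.FSmooth μ η (X ω) i) (b (X ω))) Prb ∧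
    ∫ ω, inner ℝ
      (G.batchDirection η i (X ω) (fun l => W l ω) - G.FSmooth μ η (X ω) i) (b (X ω)) ∂Prb = 0 := by
  have := isProbabilityMeasure_sphereUniform (hn i) η
  -- The batch error, set to zero off the feasible set for the sake of joint measurability; `X`
  -- never leaves that set.
  let Φ : Profile n × (Fin S → Ξ × Strat (n i)) → Strat (n i) := fun q =>
    (Prod.fst ⁻¹' G.feasible).indicator
      (fun q : Profile n × (Fin S → Ξ × Strat (n i)) => G.batchDirection η i q.1 q.2) q -
      (G.feasible.indicator (G.FSmooth μ η) q.1) i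
  have hcoord : Measurable (fun x : Profile n => x i) :=
    Continuous.measurable (by fun_prop)
  have hΦ : Measurable Φ := (hG.measurable_batchDirection i).sub
    (hcoord.comp ((hG.measurable_FSmooth hη hn hU hB).comp measurable_fst))
  have hΦe : ∀ x ∈ G.feasible, ∀ w : Fin S → Ξ × Strat (n i),
      Φ (x, w) = G.batchDirection η i x w - G.FSmooth μ η x i := fun x hx w => by
    simp [Φ, indicator, hx]
  have hΦe' : ∀ x ∈ G.feasible, ∀ w : Fin S → Ξ × Strat (n i),
      Φ (x, w) = (S : ℝ)⁻¹ • ∑ l, (G.estimator η i x (w l) - G.FSmooth μ η x i) := fun x hx w => by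
    have hS' : (S : ℝ) ≠ 0 := by positivity
    rw [hΦe x hx, batchDirection_eq, Finset.sum_sub_distrib, smul_sub]
    simp [← Nat.cast_smul_eq_nsmul ℝ, smul_smul, hS']
  have hmean := fun x (hx : x ∈ G.feasible) => by
    obtain ⟨h1, h2, h3⟩ := hG.memLp_estimator_sub hη hn hU hB hx i
    exact memLp_sampleMean hS hW hlaw hind h1 h2 (h3.trans hV)
  have hnoise := integral_noise (P := Prb) (W := fun ω l => W l ω) hX
    (measurable_pi_lambda _ hW) hXW hXf hG.isClosed_feasible.measurableSet hΦ hb hbC (V := V / S)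
    (fun x hx => by simp_rw [hΦe' x hx]; exact (hmean x hx).1)
    (fun x hx => by simp_rw [hΦe' x hx]; exact (hmean x hx).2.1)
    (fun x hx => by simp_rw [hΦe' x hx]; exact (hmean x hx).2.2)
  have e : ∀ ω, Φ (X ω, fun l => W l ω) =
      G.batchDirection η i (X ω) (fun l => W l ω) - G.FSmooth μ η (X ω) i :=
    fun ω => hΦe _ (hXf ω) _
  simp_rw [e] at hnoise
  exact hnoise

omit [IsProbabilityMeasure μ] in
theorem IsLipschitzGame.iterate_mem_feasible (hG : G.IsLipschitzGame μ η Lip) {S : ℕ}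
    {x₀ : Profile n} (hx₀ : x₀ ∈ G.feasible) (γ : ℕ → ℝ)
    (w : ℕ → (i : Fin N) → Fin S → Ξ × Strat (n i)) (k : ℕ) :
    G.iterate η γ x₀ w k ∈ G.feasible := by
  cases k with
  | zero => exact hx₀
  | succ k => exact fun i => (euclProj_spec (hG.closed i) (hG.convex i) ⟨_, hx₀ i⟩ _).1

omit [IsProbabilityMeasure μ] in
/-- The iterates depend measurably on the samples of the previous iterations. -/
theorem IsLipschitzGame.measurable_iterate (hG : G.IsLipschitzGame μ η Lip) {S : ℕ}
    {x₀ : Profile n} (hx₀ : x₀ ∈ G.feasible) (γ : ℕ → ℝ) {Ω : Type*}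
    (w : ℕ → (i : Fin N) → Fin S → Ω → Ξ × Strat (n i)) (k : ℕ) (mΩ : MeasurableSpace Ω)
    (hw : ∀ j < k, ∀ i l, Measurable (w j i l)) :
    Measurable (fun ω => G.iterate η γ x₀ (fun k i l => w k i l ω) k) := by
  induction k with
  | zero => exact measurable_const
  | succ k ih =>
    have ih' := ih fun j hj => hw j (hj.trans (Nat.lt_succ_self k))
    refine (WithLp.measurable_toLp 2 _).comp (measurable_pi_lambda _ fun i => ?_)
    refine (euclProj_lipschitz (hG.closed i) (hG.convex i) ⟨_, hx₀ i⟩).continuous.measurable.comp ?_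
    have hcoord : Measurable (fun x : Profile n => x i) :=
      Continuous.measurable (by fun_prop)
    refine (hcoord.comp ih').sub (Measurable.const_smul ?_ (γ k))
    have h := (hG.measurable_batchDirection (S := S) i).comp
      (ih'.prodMk (measurable_pi_lambda (fun ω l => w k i l ω) fun l => hw k (Nat.lt_succ_self k) i l))
    convert h using 1
    ext1 ω
    simp [indicator, hG.iterate_mem_feasible hx₀ γ _ k]

end StochGame

/-! ### The smoothed game: exact step, one-step inequality, random output. -/

namespace StochGame
variable {N : ℕ} {n : Fin N → ℕ} {Ξ : Type*} [MeasurableSpace Ξ] {G : StochGame n Ξ}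
  {μ : Measure Ξ} [IsProbabilityMeasure μ] {η σm : ℝ} {Lip : Fin N → ℝ≥0}

/-- The exact projected gradient step of the smoothed game. -/
noncomputable def exactStep (G : StochGame n Ξ) (μ : Measure Ξ) (η γ : ℝ) (x : Profile n) :
    Profile n :=
  euclProj G.feasible (x - γ • G.FSmooth μ η x)

omit [IsProbabilityMeasure μ] in
theorem norm_residual_sq (G : StochGame n Ξ) (η : ℝ) {L : ℝ} (hL : 0 < L) (x : Profile n) :
    ‖G.residual μ η (1 / (2 * L)) x‖ ^ 2 =
      4 * L ^ 2 * ‖x - G.exactStep μ η (1 / (2 * L)) x‖ ^ 2 := by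
  rw [residual, exactStep, norm_smul, mul_pow, Real.norm_of_nonneg (by positivity)]
  congr 1
  field_simp
  norm_num

section Deterministic
variable {P : Profile n → ℝ} {L : ℝ}

theorem descent (hG : G.IsLipschitzGame μ η Lip) (hη : 0 < η) (hn : ∀ i, 0 < n i)
    (hU : G.Unbiased μ) (hP : G.IsSmoothedPotential μ η P) (hPL : IsLSmoothOn L P G.feasible) :
    ∀ x ∈ G.feasible, ∀ y ∈ G.feasible,
      P y ≤ P x + inner ℝ (G.FSmooth μ η x) (y - x) + L / 2 * ‖y - x‖ ^ 2 := by
  obtain ⟨g, hg, hgL⟩ := hPL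
  intro x hx y hy
  exact le_of_lipschitz_gradientWithin hG.convex_feasible hg hgL
    (fun x hx z hz => hP.inner_FSmooth_eq hG hη hn hU hx hz (hg x hx)) hx hy

omit [IsProbabilityMeasure μ] in
theorem IsLipschitzGame.exactStep_spec (hG : G.IsLipschitzGame μ η Lip) (γ : ℝ) {x : Profile n}
    (hx : x ∈ G.feasible) :
    G.exactStep μ η γ x ∈ G.feasible ∧ ∀ z ∈ G.feasible,
      inner ℝ (x - γ • G.FSmooth μ η x - G.exactStep μ η γ x) (z - G.exactStep μ η γ x) ≤ 0 :=
  euclProj_spec hG.isClosed_feasible hG.convex_feasible ⟨x, hx⟩ _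

omit [IsProbabilityMeasure μ] in
/-- The simultaneous update is the projection onto the product set, in variational form. -/
theorem IsLipschitzGame.update_spec (hG : G.IsLipschitzGame μ η Lip) (γ : ℝ) {x D p : Profile n}
    (hx : x ∈ G.feasible) (hp : ∀ i, p i = euclProj (G.X i) (x i - γ • D i)) :
    p ∈ G.feasible ∧ ∀ z ∈ G.feasible, inner ℝ (x - γ • D - p) (z - p) ≤ 0 := by
  have h := fun i => euclProj_spec (hG.closed i) (hG.convex i) ⟨_, hx i⟩ (x i - γ • D i)
  refine ⟨fun i => by rw [hp i]; exact (h i).1, fun z hz => ?_⟩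
  rw [PiLp.inner_apply]
  refine Finset.sum_nonpos fun i _ => ?_
  have := (h i).2 (z i) (hz i)
  rw [← hp i] at this
  simpa using this

/-- A uniform bound on the exact step, which yields all integrability of residuals and noise
products without moment bounds on the iterates. -/
theorem norm_sub_exactStep_sq_le (hG : G.IsLipschitzGame μ η Lip) (hη : 0 < η) (hn : ∀ i, 0 < n i)
    (hU : G.Unbiased μ) (hP : G.IsSmoothedPotential μ η P) (hL : 0 < L)
    (hPL : IsLSmoothOn L P G.feasible) {Pmin Pmax : ℝ} (hmin : IsLeast (P '' G.feasible) Pmin)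
    (hmax : IsGreatest (P '' G.feasible) Pmax) {x : Profile n} (hx : x ∈ G.feasible) :
    ‖x - G.exactStep μ η (1 / (2 * L)) x‖ ^ 2 ≤ 2 / (3 * L) * (Pmax - Pmin) := by
  obtain ⟨hq, hqv⟩ := hG.exactStep_spec (1 / (2 * L)) hx
  have h := norm_sub_sq_le_of_descent hL (descent hG hη hn hU hP hPL) hx hq hqv
  have h1 := hmax.2 ⟨x, hx, rfl⟩
  have h2 := hmin.2 ⟨_, hq, rfl⟩
  rw [div_mul_eq_mul_div, le_div_iff₀ (by positivity)]
  nlinarith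

theorem IsLipschitzGame.measurable_exactStep (hG : G.IsLipschitzGame μ η Lip) (hη : 0 < η)
    (hn : ∀ i, 0 < n i) (hU : G.Unbiased μ) (hB : G.BoundedSecondMoment μ σm) (γ : ℝ)
    (hne : G.feasible.Nonempty) :
    Measurable (G.feasible.indicator fun x => G.exactStep μ η γ x - x) := by
  have h1 : Measurable fun x =>
      euclProj G.feasible (x - γ • G.feasible.indicator (G.FSmooth μ η) x) - x :=
    ((euclProj_lipschitz hG.isClosed_feasible hG.convex_feasible hne).continuous.measurable.comp
      (measurable_id.sub ((hG.measurable_FSmooth hη hn hU hB).const_smul γ))).sub measurable_id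
  convert h1.indicator hG.isClosed_feasible.measurableSet using 1
  ext1 x
  by_cases hx : x ∈ G.feasible
  · simp [indicator, hx, exactStep]
  · simp [indicator, hx]

end Deterministic

section Expectation
variable {P : Profile n → ℝ} {L : ℝ} {Ω : Type*} [mΩ : MeasurableSpace Ω] {Prb : Measure Ω}
  [IsProbabilityMeasure Prb] {S T : ℕ} {w : ℕ → (i : Fin N) → Fin S → Ω → Ξ × Strat (n i)}
  {R : Ω → ℕ} {x₀ : Profile n}

omit [IsProbabilityMeasure μ] [IsProbabilityMeasure Prb] in
/-- An iterate is independent of the samples of its own iteration. -/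
theorem indepFun_iterate (hG : G.IsLipschitzGame μ η Lip)
    (hs : IsSampling μ Prb η S T w R) (hx₀ : x₀ ∈ G.feasible) (γ : ℕ → ℝ) (k : ℕ) (i : Fin N) :
    IndepFun (fun ω => G.iterate η γ x₀ (fun k i l => w k i l ω) k) (fun ω l => w k i l ω) Prb := by
  let W : ℕ → Ω → (i : Fin N) → Fin S → Ξ × Strat (n i) := fun k ω i l => w k i l ω
  have hW : ∀ k, Measurable (W k) := fun k =>
    measurable_pi_lambda _ fun i => measurable_pi_lambda _ fun l => hs.measurable_w k i l
  let m : ℕ → MeasurableSpace Ω := fun k => MeasurableSpace.comap (W k) inferInstance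
  have hind : Indep (⨆ j ∈ Iio k, m j) (⨆ j ∈ ({k} : Set ℕ), m j) Prb :=
    indep_iSup_of_disjoint (fun k => (hW k).comap_le) hs.indep_iter.iIndep (by simp)
  have hX : Measurable[⨆ j ∈ Iio k, m j]
      (fun ω => G.iterate η γ x₀ (fun k i l => w k i l ω) k) := by
    refine hG.measurable_iterate hx₀ γ w k _ fun j hj i l => ?_
    have h1 : Measurable[m j] (W j) := comap_measurable _
    have he : Measurable fun f : (i : Fin N) → Fin S → Ξ × Strat (n i) => f i l :=
      (measurable_pi_apply l).comp (measurable_pi_apply i)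
    exact (he.comp h1).mono (le_iSup₂_of_le j hj le_rfl) le_rfl
  have hXW : IndepFun (fun ω => G.iterate η γ x₀ (fun k i l => w k i l ω) k) (W k) Prb := by
    rw [IndepFun_iff_Indep]
    refine indep_of_indep_of_le_left (indep_of_indep_of_le_right hind ?_) hX.comap_le
    exact le_iSup₂_of_le k (mem_singleton k) le_rfl
  exact hXW.comp measurable_id (measurable_pi_apply i)

omit [IsProbabilityMeasure Prb] in
theorem integrable_comp_of_mem [IsFiniteMeasure Prb] {K : Set (Profile n)}
    (hPL : IsLSmoothOn L P K) {Pmin Pmax : ℝ} (hmin : IsLeast (P '' K) Pmin)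
    (hmax : IsGreatest (P '' K) Pmax) {X : Ω → Profile n} (hX : Measurable X)
    (hXK : ∀ ω, X ω ∈ K) : Integrable (fun ω => P (X ω)) Prb := by
  have hPc : ContinuousOn P K := by
    obtain ⟨g, hg, -⟩ := hPL
    exact fun x hx => (hg x hx).hasFDerivWithinAt.continuousWithinAt
  refine Integrable.of_bound (C := max |Pmin| |Pmax|) ?_ (Eventually.of_forall fun ω => ?_)
  · exact ((continuousOn_iff_continuous_domRestrict.1 hPc).measurable.comp
      (hX.subtype_mk (h := hXK))).aestronglyMeasurable
  · exact abs_le_max_abs_abs (hmin.2 ⟨_, hXK ω, rfl⟩) (hmax.2 ⟨_, hXK ω, rfl⟩)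

/-- The inexact step inequality in expectation: the exact displacement is a bounded function of the
current iterate, so its product with the noise has mean zero. Squared norm and inner product split
over players, so dependence between players within an iteration does no harm; the split produces the
factor `N`. -/
theorem integral_step_le (hG : G.IsLipschitzGame μ η Lip) (hη : 0 < η) (hn : ∀ i, 0 < n i)
    (hU : G.Unbiased μ) (hB : G.BoundedSecondMoment μ σm) (hP : G.IsSmoothedPotential μ η P)
    (hL : 0 < L) (hPL : IsLSmoothOn L P G.feasible) {Pmin Pmax : ℝ}
    (hmin : IsLeast (P '' G.feasible) Pmin) (hmax : IsGreatest (P '' G.feasible) Pmax)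
    (hS : 0 < S) (hs : IsSampling μ Prb η S T w R) (hx₀ : x₀ ∈ G.feasible) {γ : ℕ → ℝ} {k : ℕ}
    (hγ : γ k = 1 / (2 * L)) {V : ℝ}
    (hV : ∀ i, 32 * √(2 * Real.pi) * (Lip i : ℝ) ^ 2 * n i + 2 * σm ^ 2 ≤ V)
    (X : ℕ → Ω → Profile n)
    (hX : X = fun k ω => G.iterate η γ x₀ (fun k i l => w k i l ω) k) :
    3 * L / 4 * ∫ ω, ‖X k ω - G.exactStep μ η (1 / (2 * L)) (X k ω)‖ ^ 2 ∂Prb ≤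
      ∫ ω, P (X k ω) ∂Prb - ∫ ω, P (X (k + 1) ω) ∂Prb + 7 / (8 * L) * (N * (V / S)) := by
  have hXf : ∀ k ω, X k ω ∈ G.feasible := fun k ω => by
    rw [hX]; exact hG.iterate_mem_feasible hx₀ γ _ k
  have hXm : ∀ k, Measurable (X k) := fun k => by
    rw [hX]; exact hG.measurable_iterate hx₀ γ w k _ fun j _ i l => hs.measurable_w j i l
  have hdesc := descent hG hη hn hU hP hPL
  have hPint : ∀ k, Integrable (fun ω => P (X k ω)) Prb := fun k =>
    integrable_comp_of_mem hPL hmin hmax (hXm k) (hXf k)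
  set b : Profile n → Profile n :=
    G.feasible.indicator fun x => G.exactStep μ η (1 / (2 * L)) x - x with hb
  have hbm : Measurable b := hG.measurable_exactStep hη hn hU hB _ ⟨x₀, hx₀⟩
  have hbe : ∀ ω, b (X k ω) = G.exactStep μ η (1 / (2 * L)) (X k ω) - X k ω := fun ω => by
    simp [b, hXf k ω]
  set C := √(2 / (3 * L) * (Pmax - Pmin))
  have hbC : ∀ x, ‖b x‖ ≤ C := fun x => by
    by_cases hx : x ∈ G.feasible
    · rw [hb, indicator_of_mem hx, norm_sub_rev]
      exact Real.le_sqrt_of_sq_le (norm_sub_exactStep_sq_le hG hη hn hU hP hL hPL hmin hmax hx)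
    · rw [hb, indicator_of_notMem hx, norm_zero]
      exact Real.sqrt_nonneg _
  let D : Ω → Profile n := fun ω =>
    WithLp.toLp 2 fun i => G.batchDirection η i (X k ω) (fun l => w k i l ω)
  let δ : Ω → Profile n := fun ω => D ω - G.FSmooth μ η (X k ω)
  have hnoise := fun i => hG.integral_batch_error hS hη hn hU hB i (hs.measurable_w k i)
    (hs.law_w k i) (hs.indep_batch k i) (hXm k)
    (by rw [hX]; exact indepFun_iterate hG hs hx₀ γ k i) (hXf k)
    (b := fun x => b x i) ((Continuous.measurable (by fun_prop : Continuous fun x : Profile n => x i)).comp hbm)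
    (C := C) (fun x => (PiLp.norm_apply_le (b x) i).trans (hbC x)) (hV i)
  have hδsq : ∀ ω, ‖δ ω‖ ^ 2 = ∑ i,
      ‖G.batchDirection η i (X k ω) (fun l => w k i l ω) - G.FSmooth μ η (X k ω) i‖ ^ 2 :=
    fun ω => by rw [PiLp.norm_sq_eq_of_L2]; rfl
  have hδin : ∀ ω, inner ℝ (δ ω) (b (X k ω)) = ∑ i, inner ℝ
      (G.batchDirection η i (X k ω) (fun l => w k i l ω) - G.FSmooth μ η (X k ω) i)
      (b (X k ω) i) := fun ω => by rw [PiLp.inner_apply]; rfl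
  have hsqint : Integrable (fun ω => ‖δ ω‖ ^ 2) Prb := by
    simp_rw [hδsq]; exact integrable_finsetSum _ fun i _ => (hnoise i).1
  have hinint : Integrable (fun ω => inner ℝ (δ ω) (b (X k ω))) Prb := by
    simp_rw [hδin]; exact integrable_finsetSum _ fun i _ => (hnoise i).2.2.1
  have hsqle : ∫ ω, ‖δ ω‖ ^ 2 ∂Prb ≤ N * (V / S) := by
    simp_rw [hδsq]
    rw [integral_finsetSum _ fun i _ => (hnoise i).1]
    refine (Finset.sum_le_sum fun i _ => (hnoise i).2.1).trans_eq ?_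
    simp
  have hinz : ∫ ω, inner ℝ (δ ω) (b (X k ω)) ∂Prb = 0 := by
    simp_rw [hδin]
    rw [integral_finsetSum _ fun i _ => (hnoise i).2.2.1]
    exact Finset.sum_eq_zero fun i _ => (hnoise i).2.2.2
  have hpt : ∀ ω, 3 * L / 4 * ‖X k ω - G.exactStep μ η (1 / (2 * L)) (X k ω)‖ ^ 2 ≤
      P (X k ω) - P (X (k + 1) ω) + 7 / (8 * L) * ‖δ ω‖ ^ 2 - inner ℝ (δ ω) (b (X k ω)) := by
    intro ω
    obtain ⟨hq, hqv⟩ := hG.exactStep_spec (1 / (2 * L)) (hXf k ω)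
    obtain ⟨hp, hpv⟩ := hG.update_spec (1 / (2 * L)) (D := D ω) (p := X (k + 1) ω) (hXf k ω)
      (fun i => by rw [← hγ, hX]; simp only [D, hX]; rfl)
    rw [hbe]
    exact norm_sub_sq_le_of_inexact_descent hL hdesc (hXf k ω) hp hq hpv hqv
  have i1 : Integrable (fun ω => P (X k ω) - P (X (k + 1) ω)) Prb := (hPint k).sub (hPint (k + 1))
  have i2 : Integrable (fun ω => P (X k ω) - P (X (k + 1) ω) + 7 / (8 * L) * ‖δ ω‖ ^ 2) Prb :=
    i1.add (hsqint.const_mul _)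
  rw [← integral_const_mul]
  refine (integral_mono_of_nonneg (Eventually.of_forall fun ω => by positivity) (i2.sub hinint)
    (Eventually.of_forall hpt)).trans ?_
  simp only [Pi.sub_apply]
  rw [integral_sub i2 hinint, integral_add i1 (hsqint.const_mul _), integral_sub (hPint _) (hPint _),
    integral_const_mul, hinz, sub_zero]
  gcongr

/-- The expected squared residual at the random output. -/
theorem integral_residual_le (hG : G.IsLipschitzGame μ η Lip) (hη : 0 < η) (hn : ∀ i, 0 < n i)
    (hU : G.Unbiased μ) (hB : G.BoundedSecondMoment μ σm) (hP : G.IsSmoothedPotential μ η P)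
    (hL : 0 < L) (hPL : IsLSmoothOn L P G.feasible) {Pmin Pmax : ℝ}
    (hmin : IsLeast (P '' G.feasible) Pmin) (hmax : IsGreatest (P '' G.feasible) Pmax)
    (hS : 0 < S) (hT : 0 < T) (hs : IsSampling μ Prb η S T w R) (hx₀ : x₀ ∈ G.feasible) {γ : ℕ → ℝ}
    (hγ : ∀ k ∈ Finset.Icc 1 T, γ k = 1 / (2 * L)) {V : ℝ}
    (hV : ∀ i, 32 * √(2 * Real.pi) * (Lip i : ℝ) ^ 2 * n i + 2 * σm ^ 2 ≤ V) :
    Integrable (fun ω => ‖G.residual μ η (γ (R ω))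
      (G.iterate η γ x₀ (fun k i l => w k i l ω) (R ω))‖ ^ 2) Prb ∧
    ∫ ω, ‖G.residual μ η (γ (R ω))
      (G.iterate η γ x₀ (fun k i l => w k i l ω) (R ω))‖ ^ 2 ∂Prb ≤
        16 * L / 3 * (Pmax - Pmin) / T + 14 / 3 * (N * (V / S)) := by
  set X : ℕ → Ω → Profile n := fun k ω => G.iterate η γ x₀ (fun k i l => w k i l ω) k with hX
  have hXf : ∀ k ω, X k ω ∈ G.feasible := fun k ω => hG.iterate_mem_feasible hx₀ γ _ k
  let W : Ω → (k : ℕ) → (i : Fin N) → Fin S → Ξ × Strat (n i) := fun ω k i l => w k i l ω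
  have hW : Measurable W := measurable_pi_lambda _ fun k => measurable_pi_lambda _ fun i =>
    measurable_pi_lambda _ fun l => hs.measurable_w k i l
  have hXW : ∀ k, Measurable[MeasurableSpace.comap W inferInstance] (X k) := fun k => by
    refine hG.measurable_iterate hx₀ γ w k _ fun j hj i l => ?_
    have h1 : Measurable[MeasurableSpace.comap W inferInstance] W := comap_measurable _
    have he : Measurable fun f : (k : ℕ) → (i : Fin N) → Fin S → Ξ × Strat (n i) => f j i l :=
      (measurable_pi_apply l).comp ((measurable_pi_apply i).comp (measurable_pi_apply j))
    exact he.comp h1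
  have hXm : ∀ k, Measurable (X k) := fun k => (hXW k).mono hW.comap_le le_rfl
  have hRX : ∀ k, IndepFun R (X k) Prb := fun k => by
    have h := hs.indep_R
    rw [IndepFun_iff_Indep] at h ⊢
    exact indep_of_indep_of_le_right h (hXW k).comap_le
  let r : Profile n → ℝ := fun x =>
    4 * L ^ 2 * ‖G.feasible.indicator (fun x => G.exactStep μ η (1 / (2 * L)) x - x) x‖ ^ 2
  have hrm : Measurable r :=
    ((hG.measurable_exactStep hη hn hU hB _ ⟨x₀, hx₀⟩).norm.pow_const 2).const_mul _
  have hrX : ∀ k ω, r (X k ω) =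
      4 * L ^ 2 * ‖X k ω - G.exactStep μ η (1 / (2 * L)) (X k ω)‖ ^ 2 := fun k ω => by
    simp only [r, indicator_of_mem (hXf k ω)]
    rw [norm_sub_rev]
  have hrint : ∀ k, Integrable (fun ω => r (X k ω)) Prb := fun k => by
    refine Integrable.of_bound (C := 4 * L ^ 2 * (2 / (3 * L) * (Pmax - Pmin)))
      (hrm.comp (hXm k)).aestronglyMeasurable (Eventually.of_forall fun ω => ?_)
    rw [hrX, Real.norm_of_nonneg (by positivity)]
    gcongr
    exact norm_sub_exactStep_sq_le hG hη hn hU hP hL hPL hmin hmax (hXf k ω)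
  -- The random index is resolved by summing $1_{\{R=k\}}\,r(x^k)$ over `k`; independence of `R`
  -- from the samples gives each term the weight $1/T$.
  let I : ℕ → ℕ → ℝ := fun k => ({k} : Set ℕ).indicator 1
  have hT' : (0 : ℝ) < T := by exact_mod_cast hT
  have hRk : ∀ k, MeasurableSet {ω | R ω = k} := fun k => hs.measurable_R (measurableSet_singleton k)
  have hIint : ∀ k ∈ Finset.Icc 1 T, ∫ ω, I k (R ω) ∂Prb = 1 / T := fun k hk => by
    have : (fun ω => I k (R ω)) = {ω | R ω = k}.indicator 1 := by
      ext ω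
      by_cases h : R ω = k <;> simp [I, h]
    rw [this, integral_indicator_one (hRk k), measureReal_def, hs.law_R k hk]
    simp
  have hRae : ∀ᵐ ω ∂Prb, R ω ∈ Finset.Icc 1 T := by
    have hu : Prb {ω | R ω ∈ Finset.Icc 1 T} = 1 := by
      have e : {ω | R ω ∈ Finset.Icc 1 T} = ⋃ k ∈ Finset.Icc 1 T, {ω | R ω = k} := by
        ext ω; simp
      rw [e, measure_biUnion_finset _ fun k _ => hRk k, Finset.sum_congr rfl hs.law_R]
      · simp only [Finset.sum_const, Nat.card_Icc, Nat.add_sub_cancel, nsmul_eq_mul]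
        exact ENNReal.mul_inv_cancel (by exact_mod_cast hT.ne') (ENNReal.natCast_ne_top T)
      · intro a _ c _ hac
        exact Set.disjoint_left.2 fun ω h1 h2 => hac (h1.symm.trans h2)
    exact (prob_compl_eq_zero_iff (hs.measurable_R (Finset.measurableSet _))).2 hu
  have hsum : ∀ᵐ ω ∂Prb, ∑ k ∈ Finset.Icc 1 T, I k (R ω) * r (X k ω) =
      ‖G.residual μ η (γ (R ω)) (X (R ω) ω)‖ ^ 2 := by
    filter_upwards [hRae] with ω hω
    rw [Finset.sum_eq_single (R ω)]
    · rw [hγ _ hω, norm_residual_sq G η hL, hrX]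
      simp [I]
    · intro k _ hk
      simp [I, hk.symm]
    · exact fun h => absurd hω h
  have hind : ∀ k, IndepFun (fun ω => I k (R ω)) (fun ω => r (X k ω)) Prb := fun k =>
    (hRX k).comp (measurable_from_nat : Measurable (I k)) hrm
  have hImeas : ∀ k, Measurable (fun ω => I k (R ω)) := fun k =>
    (measurable_from_nat : Measurable (I k)).comp hs.measurable_R
  have hterm : ∀ k, Integrable (fun ω => I k (R ω) * r (X k ω)) Prb := fun k => by
    refine (hrint k).bdd_mul (c := 1) (hImeas k).aestronglyMeasurable (Eventually.of_forall fun ω => ?_)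
    by_cases h : R ω = k <;> simp [I, h]
  have hval : ∀ k ∈ Finset.Icc 1 T, ∫ ω, I k (R ω) * r (X k ω) ∂Prb =
      1 / T * ∫ ω, r (X k ω) ∂Prb := fun k hk => by
    rw [(hind k).integral_fun_mul_eq_mul_integral (hImeas k).aestronglyMeasurable
      (hrint k).aestronglyMeasurable, hIint k hk]
  refine ⟨(integrable_finsetSum _ fun k _ => hterm k).congr hsum, ?_⟩
  rw [← integral_congr_ae hsum, integral_finsetSum _ fun k _ => hterm k, Finset.sum_congr rfl hval,
    ← Finset.mul_sum]
  -- The factor is $\frac{16L}{3}=4L^2\big/\frac{3L}{4}$.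
  have hstep : ∀ k ∈ Finset.Icc 1 T, ∫ ω, r (X k ω) ∂Prb ≤ 16 * L / 3 *
      ((∫ ω, P (X k ω) ∂Prb - ∫ ω, P (X (k + 1) ω) ∂Prb) + 7 / (8 * L) * (N * (V / S))) := by
    intro k hk
    have h := integral_step_le hG hη hn hU hB hP hL hPL hmin hmax hS hs hx₀ (hγ k hk) hV X hX
    simp_rw [hrX]
    rw [integral_const_mul]
    have h2 := mul_le_mul_of_nonneg_left h (show 0 ≤ 16 * L / 3 by positivity)
    refine le_trans (le_of_eq ?_) h2
    ring
  -- The sum starts at $x^1$. The step size at $x^0$ is unconstrained, but feasibility of $x^1$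
  -- alone gives $P(x^1)\le P_{\max}$.
  have htel : ∑ k ∈ Finset.Icc 1 T, (∫ ω, P (X k ω) ∂Prb - ∫ ω, P (X (k + 1) ω) ∂Prb) ≤
      Pmax - Pmin := by
    have e : ∑ k ∈ Finset.Icc 1 T, (∫ ω, P (X k ω) ∂Prb - ∫ ω, P (X (k + 1) ω) ∂Prb) =
        ∫ ω, P (X 1 ω) ∂Prb - ∫ ω, P (X (T + 1) ω) ∂Prb := by
      rw [← Finset.Ico_add_one_right_eq_Icc, Finset.sum_Ico_eq_sum_range, Nat.add_sub_cancel]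
      have := Finset.sum_range_sub' (fun k => ∫ ω, P (X (1 + k) ω) ∂Prb) T
      simpa only [add_assoc, add_zero, add_comm 1 T] using this
    rw [e]
    have hPint : ∀ k, Integrable (fun ω => P (X k ω)) Prb := fun k =>
      integrable_comp_of_mem hPL hmin hmax (hXm k) (hXf k)
    have u : ∫ ω, P (X 1 ω) ∂Prb ≤ Pmax := by
      simpa using integral_mono (hPint 1) (integrable_const Pmax)
        fun ω => hmax.2 ⟨_, hXf 1 ω, rfl⟩
    have l : Pmin ≤ ∫ ω, P (X (T + 1) ω) ∂Prb := by
      simpa using integral_mono (integrable_const Pmin) (hPint (T + 1))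
        fun ω => hmin.2 ⟨_, hXf (T + 1) ω, rfl⟩
    exact sub_le_sub u l
  refine (mul_le_mul_of_nonneg_left (Finset.sum_le_sum hstep) (by positivity)).trans ?_
  rw [← Finset.mul_sum, Finset.sum_add_distrib, Finset.sum_const, Nat.card_Icc, Nat.add_sub_cancel,
    nsmul_eq_mul]
  calc 1 / (T : ℝ) * (16 * L / 3 * (∑ k ∈ Finset.Icc 1 T,
        (∫ ω, P (X k ω) ∂Prb - ∫ ω, P (X (k + 1) ω) ∂Prb) + T * (7 / (8 * L) * (N * (V / S)))))
      ≤ 1 / (T : ℝ) * (16 * L / 3 * ((Pmax - Pmin) + T * (7 / (8 * L) * (N * (V / S))))) := by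
        gcongr
    _ = _ := by
        field_simp
        ring

end Expectation

end StochGame

/-! ### Batch size, number of iterations and the final rate. -/

section Parameters

theorem sigmaTotal_pos {N : ℕ} (n : Fin N → ℕ) (Lip : Fin N → ℝ≥0) {σm : ℝ} (hσm : 0 < σm) :
    0 < sigmaTotal n Lip σm := by
  have : 0 ≤ ⨆ i, (n i : ℝ) := Real.iSup_nonneg fun i => Nat.cast_nonneg _
  exact Real.sqrt_pos.2 (by positivity)

theorem variance_le_sigmaTotal_sq {N : ℕ} (n : Fin N → ℕ) (Lip : Fin N → ℝ≥0) (σm : ℝ)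
    (i : Fin N) :
    32 * √(2 * Real.pi) * (Lip i : ℝ) ^ 2 * n i + 2 * σm ^ 2 ≤ sigmaTotal n Lip σm ^ 2 := by
  have h0 : 0 ≤ ⨆ i, (n i : ℝ) := Real.iSup_nonneg fun i => Nat.cast_nonneg _
  rw [sigmaTotal, Real.sq_sqrt (by positivity)]
  have h1 : (Lip i : ℝ) ≤ ⨆ i, (Lip i : ℝ) :=
    le_ciSup (f := fun i => (Lip i : ℝ)) (Set.finite_range _).bddAbove i
  have h2 : (n i : ℝ) ≤ ⨆ i, (n i : ℝ) :=
    le_ciSup (f := fun i => (n i : ℝ)) (Set.finite_range _).bddAbove i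
  gcongr

/-- A budget above which at least one iteration is affordable. -/
theorem mul_batch_le_budget {N c M : ℝ} (hN : 0 ≤ N)
    (hM : 4 * N ^ 2 * c ^ 2 + 4 * N ≤ M) : N * (c * √M + 1) ≤ M := by
  have hM0 : 0 ≤ M := le_trans (by positivity) hM
  have hs := Real.sq_sqrt hM0
  -- The first summand of the threshold yields $Nc\sqrt M\le M/2$, the second $N\le M/4$.
  have h : 2 * N * c ≤ √M := by
    apply Real.le_sqrt_of_sq_le
    nlinarith
  nlinarith [mul_le_mul_of_nonneg_right h (Real.sqrt_nonneg M)]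

theorem half_le_natFloor {x : ℝ} (hx : 1 ≤ x) : x / 2 ≤ ⌊x⌋₊ := by
  have h1 : (1 : ℝ) ≤ ⌊x⌋₊ := by exact_mod_cast (Nat.one_le_floor_iff x).2 hx
  linarith [Nat.lt_floor_add_one x]

theorem le_iterLimit (N S M₀ M₁ : ℕ) :
    ⌊budget M₀ M₁ / (S * N)⌋₊ ≤ iterLimit N S M₀ M₁ := by
  refine le_min ?_ ?_ <;> refine Nat.floor_le_floor (div_le_div_of_nonneg_right ?_ (by positivity))
  · exact min_le_left _ _
  · exact min_le_right _ _

/-- The optimization term grows linearly in `S` and the noise term decays like $1/S$; at `s` both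
are multiples of $\sqrt6\,LDN\sigma/\sqrt M$, with coefficients $8/3$ and $28/9$ and sum $52/9\le
8$. Rounding `S` up contributes the $1/M$ term, with $32/3\le 16$. The halving in the bound on `T`
pays for the floor. -/
theorem rate_le {N L D M σ S T s : ℝ} (hN : 0 < N) (hL : 0 < L) (hD : 0 < D) (hM : 0 < M)
    (hσ : 0 < σ) (hs : s = σ * √(6 * M) / (4 * L * D)) (hsS : s ≤ S) (hSs : S ≤ s + 1)
    (hT : M / (S * N) / 2 ≤ T) :
    16 * L / 3 * (L * D ^ 2) / T + 14 / 3 * (N * (σ ^ 2 / S)) ≤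
      16 * L ^ 2 * D ^ 2 * N / M + 8 * √6 * L * D * N * σ / √M := by
  have hr : 0 < √M := Real.sqrt_pos.2 hM
  have h6 : 0 < √6 := by positivity
  have h66 : √6 * √6 = 6 := Real.mul_self_sqrt (by norm_num)
  have hMM : M = √M * √M := (Real.mul_self_sqrt hM.le).symm
  rw [Real.sqrt_mul (by norm_num)] at hs
  set r := √M
  set q := √6
  have hs0 : 0 < s := by rw [hs]; positivity
  have hS0 : 0 < S := hs0.trans_le hsS
  have t1 : 16 * L / 3 * (L * D ^ 2) / T ≤ 32 / 3 * L ^ 2 * D ^ 2 * N * (s + 1) / M := by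
    calc 16 * L / 3 * (L * D ^ 2) / T ≤ 16 * L / 3 * (L * D ^ 2) / (M / (S * N) / 2) := by gcongr
      _ = 32 / 3 * L ^ 2 * D ^ 2 * N * S / M := by field_simp; ring
      _ ≤ _ := by gcongr
  have t2 : 14 / 3 * (N * (σ ^ 2 / S)) ≤ 14 / 3 * (N * (σ ^ 2 / s)) := by gcongr
  have e1 : 32 / 3 * L ^ 2 * D ^ 2 * N * (s + 1) / M =
      32 / 3 * (L ^ 2 * D ^ 2 * N / M) + 8 / 3 * q * (L * D * N * σ / r) := by
    rw [hs, hMM]; field_simp; ring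
  have e2 : 14 / 3 * (N * (σ ^ 2 / s)) = 28 / 9 * q * (L * D * N * σ / r) := by
    rw [hs]; field_simp; nlinarith
  have p1 : 0 ≤ L ^ 2 * D ^ 2 * N / M := by positivity
  have p2 : 0 ≤ q * (L * D * N * σ / r) := by positivity
  calc _ ≤ 32 / 3 * (L ^ 2 * D ^ 2 * N / M) + 8 / 3 * q * (L * D * N * σ / r) +
        28 / 9 * q * (L * D * N * σ / r) := by linarith
    _ ≤ 16 * (L ^ 2 * D ^ 2 * N / M) + 8 * (q * (L * D * N * σ / r)) := by nlinarith
    _ = _ := by ring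

end Parameters

/-! ### The convergence theorem. -/

theorem mainTheorem2 {N : ℕ} [NeZero N] (n : Fin N → ℕ) (hn : ∀ i, 0 < n i)
    (Lip : Fin N → ℝ≥0) (σm Lη Pmin Pmax : ℝ) (hσm : 0 < σm) (hLη : 0 < Lη) (hP : Pmin < Pmax) :
    ∃ Mbar : ℕ, ∀ M₀ M₁ : ℕ, Mbar ≤ M₀ → Mbar ≤ M₁ →
      ∀ (σ D M : ℝ) (S T : ℕ), σ = sigmaTotal n Lip σm → D = rangeD Pmin Pmax Lη →
      M = budget M₀ M₁ → S = batchSize σ Lη D M → T = iterLimit N S M₀ M₁ →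
      1 ≤ T ∧
      ∀ (Ξ : Type*) [MeasurableSpace Ξ] (μ : Measure Ξ) [IsProbabilityMeasure μ]
        (η : ℝ) (G : StochGame n Ξ) (P : Profile n → ℝ),
        0 < η → G.IsLipschitzGame μ η Lip →
        G.IsSmoothedPotential μ η P → IsLSmoothOn Lη P G.feasible →
        IsLeast (P '' G.feasible) Pmin → IsGreatest (P '' G.feasible) Pmax →
        G.Unbiased μ → G.BoundedSecondMoment μ σm →
        ∀ (Ω : Type*) [MeasurableSpace Ω] (Prb : Measure Ω) [IsProbabilityMeasure Prb]
          (w : ℕ → (i : Fin N) → Fin S → Ω → Ξ × Strat (n i)) (R : Ω → ℕ)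
          (x₀ : Profile n) (γ : ℕ → ℝ),
          IsSampling μ Prb η S T w R → x₀ ∈ G.feasible →
          (∀ k ∈ Finset.Icc 1 T, γ k = 1 / (2 * Lη)) →
          Integrable (fun ω => ‖G.residual μ η (γ (R ω))
            (G.iterate η γ x₀ (fun k i l => w k i l ω) (R ω))‖ ^ 2) Prb ∧
          ∫ ω, ‖G.residual μ η (γ (R ω))
            (G.iterate η γ x₀ (fun k i l => w k i l ω) (R ω))‖ ^ 2 ∂Prb ≤
            16 * Lη ^ 2 * D ^ 2 * N / M + 8 * √6 * Lη * D * N * σ / √M := by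
  set σ := sigmaTotal n Lip σm with hσdef
  set D := rangeD Pmin Pmax Lη with hDdef
  have hσ : 0 < σ := sigmaTotal_pos n Lip hσm
  have hD : 0 < D := Real.sqrt_pos.2 (div_pos (sub_pos.2 hP) hLη)
  have hLD : Lη * D ^ 2 = Pmax - Pmin := by
    rw [hDdef, rangeD, Real.sq_sqrt (div_nonneg (sub_nonneg.2 hP.le) hLη.le)]
    field_simp
  have hN : (0 : ℝ) < N := Nat.cast_pos.2 (NeZero.pos N)
  set c := σ * √6 / (4 * Lη * D) with hc
  -- Before rounding, the batch size is $c\sqrt M$. The outer factor 2 compensates for $M_0/2$ in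
  -- the definition of $M$.
  refine ⟨⌈2 * (4 * (N : ℝ) ^ 2 * c ^ 2 + 4 * N)⌉₊, fun M₀ M₁ h₀ h₁ => ?_⟩
  rintro _ _ M S T rfl rfl hM hS hT
  have hM₀ : 2 * (4 * (N : ℝ) ^ 2 * c ^ 2 + 4 * N) ≤ M₀ :=
    (Nat.le_ceil _).trans (Nat.cast_le.2 h₀)
  have hM₁ : 2 * (4 * (N : ℝ) ^ 2 * c ^ 2 + 4 * N) ≤ M₁ :=
    (Nat.le_ceil _).trans (Nat.cast_le.2 h₁)
  have hMge : 4 * (N : ℝ) ^ 2 * c ^ 2 + 4 * N ≤ M := by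
    rw [hM]
    refine le_min (by linarith) (le_trans ?_ hM₁)
    have : (0 : ℝ) ≤ 4 * (N : ℝ) ^ 2 * c ^ 2 + 4 * N := by positivity
    linarith
  have hMpos : 0 < M := lt_of_lt_of_le (by positivity) hMge
  set s := σ * √(6 * M) / (4 * Lη * D) with hs
  have hsc : s = c * √M := by rw [hs, hc, Real.sqrt_mul (by norm_num)]; ring
  have hs0 : 0 < s := by positivity
  have hsS : s ≤ S := by rw [hS]; exact Nat.le_ceil _
  have hSs : (S : ℝ) ≤ s + 1 := by rw [hS]; exact (Nat.ceil_lt_add_one hs0.le).le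
  have hS0 : (0 : ℝ) < S := hs0.trans_le hsS
  have hone : 1 ≤ M / (S * N) := by
    rw [le_div_iff₀ (by positivity), one_mul]
    refine le_trans ?_ (mul_batch_le_budget hN.le hMge)
    rw [← hsc, mul_comm]
    gcongr
  have hTfl : ⌊M / (S * N)⌋₊ ≤ T := by rw [hT, hM]; exact le_iterLimit N S M₀ M₁
  have hT1 : 1 ≤ T := ((Nat.one_le_floor_iff _).2 hone).trans hTfl
  have hTle : M / (S * N) / 2 ≤ T := (half_le_natFloor hone).trans (Nat.cast_le.2 hTfl)
  refine ⟨hT1, ?_⟩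
  intro Ξ _ μ _ η G P hη hG hpot hPL hmin hmax hU hB Ω _ Prb _ w R x₀ γ hsamp hx₀ hγ
  obtain ⟨hint, hle⟩ := StochGame.integral_residual_le hG hη hn hU hB hpot hLη hPL hmin hmax
    (Nat.cast_pos.1 hS0) hT1 hsamp hx₀ hγ (V := σ ^ 2)
    (fun i => variance_le_sigmaTotal_sq n Lip σm i)
  refine ⟨hint, hle.trans ?_⟩
  rw [← hLD]
  exact rate_le hN hLη hD hMpos hσ hs hsS hSs hTle
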